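/- Let $d\in\mathbb N$ and let $s,t>0$ satisfy $s+t>1$. Let $\Sigma_t^s(\mathbb R^d)$ be the Beurling type Gelfand--Shilov space of all $f\in C^\infty(\mathbb R^d)$ such that $$\|f\|_h=\sup_{\alpha,\beta\in\mathbb N^d,\ x\in\mathbb R^d}\frac{|x^\alpha D^\beta f(x)|}{h^{|\alpha+\beta|}\,\alpha!^{\,t}\,\beta!^{\,s}}<\infty\qquad\text{for every } h>0,$$ with the Fréchet topology defined by the norms $\|\cdot\|_h$, $h>0$, and let $(\Sigma_t^s)'(\mathbb R^d)$ be the space of continuous conjugate linear functionals $\phi\mapsto(u,\phi)$ on it. For $u\in(\Sigma_t^s)'(\mathbb R^d)$ and $\psi\in\Sigma_t^s(\mathbb R^d)\setminus 0$ let $$V_\psi u(x,\xi)=(2\pi)^{-d/2}\,\bigl(u,\ e^{i\langle\cdot,\xi\rangle}\psi(\cdot-x)\bigr),\qquad x,\xi\in\mathbb R^d,$$ be the short-time Fourier transform. For a set $U\subseteq T^*\mathbb R^d\setminus 0=\mathbb R^{2d}\setminus\{0\}$ consider the condition $$\sup_{\lambda>0,\ (x,\xi)\in U}e^{r\lambda}\,|V_\psi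 u(\lambda^t x,\lambda^s\xi)|<\infty\qquad\text{for all } r>0.\tag{$*$}$$ Let $\mathrm{WF}^{t,s}_\psi(u)$ be the set of all $z_0\in T^*\mathbb R^d\setminus 0$ for which there is no open set $U\subseteq T^*\mathbb R^d\setminus 0$ with $z_0\in U$ that satisfies $(*)$. Let $u\in(\Sigma_t^s)'(\mathbb R^d)$ and $\psi,\varphi\in\Sigma_t^s(\mathbb R^d)\setminus 0$. If $z_0\in T^*\mathbb R^d\setminus 0$ and $(*)$ holds for an open set $U\subseteq T^*\mathbb R^d\setminus 0$ containing $z_0$, then there exists an open set $V\subseteq U$ such that $z_0\in V$ and $$\sup_{\lambda>0,\ (x,\xi)\in V}e^{r\lambda}\,|V_\varphi u(\lambda^t x,\lambda^s\xi)|<\infty\qquad\text{for all } r>0.$$ Consequently $\mathrm{WF}^{t,s}_\psi(u)=\mathrm{WF}^{t,s}_\varphi(u)$: the anisotropic wave front set $\mathrm{WF}^{t,s}(u)$ does not depend on the window. -/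

import Mathlib

noncomputable section

namespace GelfandShilov

/-- Euclidean space `ℝ^d`. -/
abbrev RSpace (d : ℕ) : Type := EuclideanSpace ℝ (Fin d)

/-- Phase space `T^*ℝ^d = ℝ^d × ℝ^d` (only its topology is used). -/
abbrev PhaseSpace (d : ℕ) : Type := RSpace d × RSpace d

variable {d : ℕ}

section Spaces

open scoped ContDiff Nat

/-- The partial derivative `∂_i f`. -/
def pderiv (i : Fin d) (f : RSpace d → ℂ) : RSpace d → ℂ :=
  fun x => fderiv ℝ f x (EuclideanSpace.single i 1)

/-- `∂^β f = ∂_1^{β_1} ⋯ ∂_d^{β_d} f`; note `|D^β f| = |∂^β f|` for `D_j = -i ∂_j`. -/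
def multiDeriv (β : Fin d → ℕ) (f : RSpace d → ℂ) : RSpace d → ℂ :=
  (List.finRange d).foldr (fun i g => (pderiv i)^[β i] g) f

/-- The monomial `x^α = x_1^{α_1} ⋯ x_d^{α_d}`. -/
def monom (α : Fin d → ℕ) (x : RSpace d) : ℝ := ∏ i, x i ^ α i

/-- `α! = α_1! ⋯ α_d!`, as a real number. -/
def multiFactorial (α : Fin d → ℕ) : ℝ := ∏ i, ((α i)! : ℝ)

/-- The quotient `|x^α D^β f(x)| / (h^{|α+β|} α!^t β!^s)`. -/
def gsQuotient (t s h : ℝ) (f : RSpace d → ℂ)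
    (p : (Fin d → ℕ) × (Fin d → ℕ) × RSpace d) : ℝ :=
  ‖(monom p.1 p.2.2 : ℂ) * multiDeriv p.2.1 f p.2.2‖ /
    (h ^ (∑ i, (p.1 i + p.2.1 i)) * multiFactorial p.1 ^ t * multiFactorial p.2.1 ^ s)

/-! ### Algebra of partial derivatives -/

lemma contDiff_pderiv (i : Fin d) {f : RSpace d → ℂ} (hf : ContDiff ℝ ∞ f) :
    ContDiff ℝ ∞ (pderiv i f) :=
  (hf.fderiv_right (m := ∞) (by simp)).clm_apply contDiff_const

lemma pderiv_add (i : Fin d) {f g : RSpace d → ℂ} (hf : ContDiff ℝ ∞ f) (hg : ContDiff ℝ ∞ g) :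
    pderiv i (f + g) = pderiv i f + pderiv i g := by
  funext x
  simp only [pderiv, Pi.add_apply]
  rw [fderiv_add (hf.differentiable (by simp) x) (hg.differentiable (by simp) x)]
  rfl

lemma pderiv_smul (i : Fin d) (c : ℂ) {f : RSpace d → ℂ} (hf : ContDiff ℝ ∞ f) :
    pderiv i (c • f) = c • pderiv i f := by
  funext x
  simp only [pderiv, Pi.smul_apply]
  rw [fderiv_const_smul (hf.differentiable (by simp) x)]
  rfl

lemma pderiv_comm (i j : Fin d) {f : RSpace d → ℂ} (hf : ContDiff ℝ ∞ f) :
    pderiv i (pderiv j f) = pderiv j (pderiv i f) := by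
  have hd : Differentiable ℝ (fderiv ℝ f) :=
    (hf.fderiv_right (m := ∞) (by simp)).differentiable (by simp)
  funext x
  have key : ∀ v w : RSpace d,
      fderiv ℝ (fun y => fderiv ℝ f y v) x w = fderiv ℝ (fderiv ℝ f) x w v := by
    intro v w
    rw [fderiv_clm_apply (hd x) (differentiableAt_const v)]
    simp
  have hs : IsSymmSndFDerivAt ℝ f x := by
    refine (hf.contDiffAt (x := x)).isSymmSndFDerivAt ?_
    rw [minSmoothness_of_isRCLikeNormedField]
    exact WithTop.coe_le_coe.2 le_top
  unfold pderiv
  rw [key, key]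
  exact hs.eq _ _

/-- Iterated partial derivatives along a list of coordinates. -/
def listDeriv (l : List (Fin d)) (f : RSpace d → ℂ) : RSpace d → ℂ := l.foldr pderiv f

lemma multiDeriv_eq_listDeriv (β : Fin d → ℕ) (f : RSpace d → ℂ) :
    multiDeriv β f =
      listDeriv ((List.finRange d).flatMap fun i => List.replicate (β i) i) f := by
  unfold multiDeriv listDeriv
  induction List.finRange d with
  | nil => rfl
  | cons a L ih =>
    rw [List.foldr_cons, List.flatMap_cons, List.foldr_append, ← ih]
    generalize List.foldr (fun i g => (pderiv i)^[β i] g) f L = g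
    induction β a with
    | zero => rfl
    | succ n ihn => rw [Function.iterate_succ_apply', ihn, List.replicate_succ, List.foldr_cons]

lemma contDiff_listDeriv (l : List (Fin d)) {f : RSpace d → ℂ} (hf : ContDiff ℝ ∞ f) :
    ContDiff ℝ ∞ (listDeriv l f) := by
  induction l with
  | nil => exact hf
  | cons a L ih => exact contDiff_pderiv a ih

lemma listDeriv_add (l : List (Fin d)) {f g : RSpace d → ℂ} (hf : ContDiff ℝ ∞ f)
    (hg : ContDiff ℝ ∞ g) : listDeriv l (f + g) = listDeriv l f + listDeriv l g := by
  induction l with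
  | nil => rfl
  | cons a L ih =>
    change pderiv a (listDeriv L (f + g)) = _
    rw [ih, pderiv_add a (contDiff_listDeriv L hf) (contDiff_listDeriv L hg)]
    rfl

lemma listDeriv_smul (l : List (Fin d)) (c : ℂ) {f : RSpace d → ℂ} (hf : ContDiff ℝ ∞ f) :
    listDeriv l (c • f) = c • listDeriv l f := by
  induction l with
  | nil => rfl
  | cons a L ih =>
    change pderiv a (listDeriv L (c • f)) = _
    rw [ih, pderiv_smul a c (contDiff_listDeriv L hf)]
    rfl

lemma listDeriv_perm {l l' : List (Fin d)} (h : l.Perm l') {f : RSpace d → ℂ}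
    (hf : ContDiff ℝ ∞ f) : listDeriv l f = listDeriv l' f := by
  induction h with
  | nil => rfl
  | cons a _ ih => exact congrArg (pderiv a) ih
  | swap a b L => exact pderiv_comm b a (contDiff_listDeriv L hf)
  | trans _ _ ih₁ ih₂ => exact ih₁.trans ih₂

lemma listDeriv_eq_iteratedFDeriv (l : List (Fin d)) {f : RSpace d → ℂ} (hf : ContDiff ℝ ∞ f)
    (x : RSpace d) :
    listDeriv l f x =
      iteratedFDeriv ℝ l.length f x (fun j => EuclideanSpace.single (l.get j) (1 : ℝ)) := by
  induction l generalizing x with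
  | nil => simp [listDeriv]
  | cons a L ih =>
    have h1 : listDeriv L f = fun y =>
        iteratedFDeriv ℝ L.length f y (fun j => EuclideanSpace.single (L.get j) (1 : ℝ)) :=
      funext ih
    have hd : DifferentiableAt ℝ (iteratedFDeriv ℝ L.length f) x :=
      (hf.differentiable_iteratedFDeriv (m := L.length)
        (WithTop.coe_lt_coe.2 (ENat.natCast_lt_top _))) x
    change pderiv a (listDeriv L f) x = _
    rw [h1]
    unfold pderiv
    rw [fderiv_continuousMultilinear_apply_const_apply hd]
    exact (iteratedFDeriv_succ_apply_left (n := L.length) (f := f) (x := x)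
      (fun j => EuclideanSpace.single ((a :: L).get j) (1 : ℝ))).symm

lemma multiDeriv_add (β : Fin d → ℕ) {f g : RSpace d → ℂ} (hf : ContDiff ℝ ∞ f)
    (hg : ContDiff ℝ ∞ g) : multiDeriv β (f + g) = multiDeriv β f + multiDeriv β g := by
  simp only [multiDeriv_eq_listDeriv, listDeriv_add _ hf hg]

lemma multiDeriv_smul (β : Fin d → ℕ) (c : ℂ) {f : RSpace d → ℂ} (hf : ContDiff ℝ ∞ f) :
    multiDeriv β (c • f) = c • multiDeriv β f := by
  simp only [multiDeriv_eq_listDeriv, listDeriv_smul _ c hf]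

lemma multiDeriv_zero_fun (β : Fin d → ℕ) : multiDeriv β (0 : RSpace d → ℂ) = 0 := by
  simpa using multiDeriv_smul β 0 (f := (0 : RSpace d → ℂ)) contDiff_const

lemma multiFactorial_pos (α : Fin d → ℕ) : 0 < multiFactorial α :=
  Finset.prod_pos fun i _ => by exact_mod_cast Nat.factorial_pos (α i)

lemma gsDenom_pos {t s h : ℝ} (hh : 0 < h) (p : (Fin d → ℕ) × (Fin d → ℕ) × RSpace d) :
    0 < h ^ (∑ i, (p.1 i + p.2.1 i)) * multiFactorial p.1 ^ t * multiFactorial p.2.1 ^ s :=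
  mul_pos (mul_pos (pow_pos hh _) (Real.rpow_pos_of_pos (multiFactorial_pos _) _))
    (Real.rpow_pos_of_pos (multiFactorial_pos _) _)

lemma gsQuotient_nonneg {t s h : ℝ} (hh : 0 < h) (f : RSpace d → ℂ)
    (p : (Fin d → ℕ) × (Fin d → ℕ) × RSpace d) : 0 ≤ gsQuotient t s h f p :=
  div_nonneg (norm_nonneg _) (gsDenom_pos hh p).le

lemma gsQuotient_add_le {t s h : ℝ} (hh : 0 < h) {f g : RSpace d → ℂ} (hf : ContDiff ℝ ∞ f)
    (hg : ContDiff ℝ ∞ g) (p : (Fin d → ℕ) × (Fin d → ℕ) × RSpace d) :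
    gsQuotient t s h (f + g) p ≤ gsQuotient t s h f p + gsQuotient t s h g p := by
  unfold gsQuotient
  rw [← add_div, multiDeriv_add _ hf hg, Pi.add_apply, mul_add]
  exact div_le_div_of_nonneg_right (norm_add_le _ _) (gsDenom_pos hh p).le

lemma gsQuotient_smul {t s h : ℝ} (c : ℂ) {f : RSpace d → ℂ} (hf : ContDiff ℝ ∞ f)
    (p : (Fin d → ℕ) × (Fin d → ℕ) × RSpace d) :
    gsQuotient t s h (c • f) p = ‖c‖ * gsQuotient t s h f p := by
  unfold gsQuotient
  rw [multiDeriv_smul _ c hf, Pi.smul_apply, smul_eq_mul, mul_left_comm, norm_mul, mul_div_assoc]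

/-! ### The space `Σ_t^s(ℝ^d)` and its dual -/

/-- The smooth functions `f` with `sup |x^α D^β f(x)| / (h^{|α+β|} α!^t β!^s) < ∞`
for every `h > 0`. -/
def gsSubmodule (d : ℕ) (t s : ℝ) : Submodule ℂ (RSpace d → ℂ) where
  carrier := {f | ContDiff ℝ ∞ f ∧
    ∀ h : ℝ, 0 < h → BddAbove (Set.range (gsQuotient t s h f))}
  zero_mem' := by
    refine ⟨contDiff_const, fun h _ => ⟨0, ?_⟩⟩
    rintro _ ⟨p, rfl⟩
    simp [gsQuotient, multiDeriv_zero_fun]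
  add_mem' := by
    rintro f g ⟨hf, hf'⟩ ⟨hg, hg'⟩
    refine ⟨hf.add hg, fun h hh => ?_⟩
    obtain ⟨A, hA⟩ := hf' h hh
    obtain ⟨B, hB⟩ := hg' h hh
    refine ⟨A + B, ?_⟩
    rintro _ ⟨p, rfl⟩
    exact (gsQuotient_add_le hh hf hg p).trans (add_le_add (hA ⟨p, rfl⟩) (hB ⟨p, rfl⟩))
  smul_mem' := by
    rintro c f ⟨hf, hf'⟩
    refine ⟨contDiff_const.smul hf, fun h hh => ?_⟩
    obtain ⟨A, hA⟩ := hf' h hh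
    refine ⟨‖c‖ * A, ?_⟩
    rintro _ ⟨p, rfl⟩
    rw [gsQuotient_smul c hf p]
    exact mul_le_mul_of_nonneg_left (hA ⟨p, rfl⟩) (norm_nonneg _)

/-- The Beurling type Gelfand–Shilov space `Σ_t^s(ℝ^d)`, as a type of its own, so that it does
not inherit the topology of pointwise convergence. -/
def GSSpace (d : ℕ) (t s : ℝ) : Type := ↥(gsSubmodule d t s)

instance (t s : ℝ) : AddCommGroup (GSSpace d t s) :=
  inferInstanceAs (AddCommGroup ↥(gsSubmodule d t s))

instance (t s : ℝ) : Module ℂ (GSSpace d t s) :=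
  inferInstanceAs (Module ℂ ↥(gsSubmodule d t s))

/-- The function underlying an element of `Σ_t^s(ℝ^d)`. -/
def GSSpace.toFun {t s : ℝ} (f : GSSpace d t s) : RSpace d → ℂ := f.1

instance (t s : ℝ) : CoeFun (GSSpace d t s) (fun _ => RSpace d → ℂ) := ⟨GSSpace.toFun⟩

lemma GSSpace.contDiff {t s : ℝ} (f : GSSpace d t s) : ContDiff ℝ ∞ f.toFun := f.2.1

lemma GSSpace.bddAbove {t s : ℝ} (f : GSSpace d t s) {h : ℝ} (hh : 0 < h) :
    BddAbove (Set.range (gsQuotient t s h f.toFun)) := f.2.2 h hh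

/-- The norm `‖f‖_{S_{t,h}^s} = sup_{α,β,x} |x^α D^β f(x)| / (h^{|α+β|} α!^t β!^s)`,
a seminorm on `Σ_t^s(ℝ^d)` for `h > 0`. -/
def gsSeminorm (d : ℕ) (t s : ℝ) (h : Set.Ioi (0 : ℝ)) : Seminorm ℂ (GSSpace d t s) :=
  Seminorm.ofSMulLE (fun f => ⨆ p, gsQuotient t s h.1 f.toFun p)
    (by
      have : ∀ p, gsQuotient t s h.1 (GSSpace.toFun (0 : GSSpace d t s)) p = 0 := fun p => by
        change gsQuotient t s h.1 (0 : RSpace d → ℂ) p = 0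
        simp [gsQuotient, multiDeriv_zero_fun]
      simp only [this, ciSup_const])
    (fun f g => ciSup_le fun p => (gsQuotient_add_le h.2 f.contDiff g.contDiff p).trans
      (add_le_add (le_ciSup (f.bddAbove h.2) p) (le_ciSup (g.bddAbove h.2) p)))
    (fun c f => ciSup_le fun p => (gsQuotient_smul c f.contDiff p).trans_le
      (mul_le_mul_of_nonneg_left (le_ciSup (f.bddAbove h.2) p) (norm_nonneg c)))

/-- The Fréchet topology of `Σ_t^s(ℝ^d)`, defined by the seminorms `‖·‖_{S_{t,h}^s}`, `h > 0`. -/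
instance (t s : ℝ) : TopologicalSpace (GSSpace d t s) :=
  (show SeminormFamily ℂ (GSSpace d t s) (Set.Ioi (0 : ℝ)) from
    gsSeminorm d t s).moduleFilterBasis.topology

/-- The Gelfand–Shilov ultradistributions `(Σ_t^s)'(ℝ^d)`: the continuous conjugate linear
functionals `φ ↦ (u, φ)` on `Σ_t^s(ℝ^d)`. -/
abbrev GSDual (d : ℕ) (t s : ℝ) : Type := GSSpace d t s →L⋆[ℂ] ℂ

/-! ### Invariance under time-frequency shifts -/

lemma exists_pow_le {t : ℝ} (ht : 0 < t) {h : ℝ} (hh : 0 < h) {a : ℝ} (ha : 0 ≤ a) :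
    ∃ C : ℝ, 0 < C ∧ ∀ k : ℕ, a ^ k ≤ C * (h ^ k * (k ! : ℝ) ^ t) := by
  set b : ℝ := (a / h) ^ (1 / t) with hb
  have hah : 0 ≤ a / h := div_nonneg ha hh.le
  have hb0 : 0 ≤ b := Real.rpow_nonneg hah _
  have hbt : b ^ t = a / h := by
    rw [hb, ← Real.rpow_mul hah, one_div, inv_mul_cancel₀ ht.ne', Real.rpow_one]
  refine ⟨Real.exp b ^ t, Real.rpow_pos_of_pos (Real.exp_pos b) t, fun k => ?_⟩
  have h1 : b ^ k ≤ Real.exp b * k ! :=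
    (div_le_iff₀ (by positivity)).1 (Real.pow_div_factorial_le_exp b hb0 k)
  have h2 : (b ^ k) ^ t ≤ (Real.exp b * k !) ^ t :=
    Real.rpow_le_rpow (pow_nonneg hb0 k) h1 ht.le
  rw [Real.mul_rpow (Real.exp_pos b).le (by positivity)] at h2
  have h3 : (b ^ k) ^ t = (a / h) ^ k := by
    rw [← Real.rpow_natCast b k, ← Real.rpow_mul hb0, mul_comm, Real.rpow_mul hb0, hbt,
      Real.rpow_natCast]
  rw [h3, div_pow, div_le_iff₀ (pow_pos hh k)] at h2
  linarith

/-- The estimates defining `Σ_t^s`, with `|x|^k` and full derivatives in place of multi-indices. -/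
def NormEstimates (t s : ℝ) (f : RSpace d → ℂ) : Prop :=
  ∀ h : ℝ, 0 < h → ∃ C : ℝ, 0 ≤ C ∧ ∀ (k n : ℕ) (x : RSpace d),
    ‖x‖ ^ k * ‖iteratedFDeriv ℝ n f x‖ ≤ C * (h ^ (k + n) * (k ! : ℝ) ^ t * (n ! : ℝ) ^ s)

lemma factorial_sum_le (α : Fin d → ℕ) :
    ((∑ i, α i)! : ℝ) ≤ (d : ℝ) ^ (∑ i, α i) * multiFactorial α := by
  have h1 : Nat.multinomial Finset.univ α ≤ d ^ (∑ i, α i) := by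
    have := Finset.sum_pow_eq_sum_piAntidiag (Finset.univ : Finset (Fin d))
      (fun _ => (1 : ℕ)) (∑ i, α i)
    simp only [Finset.sum_const, Finset.card_univ, Fintype.card_fin, smul_eq_mul, mul_one, one_pow,
      Finset.prod_const_one, Nat.cast_id] at this
    rw [this]
    exact Finset.single_le_sum (f := fun k => Nat.multinomial Finset.univ k)
      (fun _ _ => Nat.zero_le _) (by simp [Finset.mem_piAntidiag])
  have h2 := Nat.multinomial_spec Finset.univ α
  rw [← h2]
  unfold multiFactorial
  push_cast
  rw [mul_comm]
  exact mul_le_mul_of_nonneg_right (by exact_mod_cast h1) (by positivity)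

lemma abs_monom_le (α : Fin d → ℕ) (x : RSpace d) : |monom α x| ≤ ‖x‖ ^ (∑ i, α i) := by
  unfold monom
  rw [Finset.abs_prod, ← Finset.prod_pow_eq_pow_sum]
  refine Finset.prod_le_prod (fun _ _ => abs_nonneg _) fun i _ => ?_
  rw [abs_pow]
  exact pow_le_pow_left₀ (abs_nonneg _) (by simpa using PiLp.norm_apply_le x i) _

lemma length_flat (β : Fin d → ℕ) :
    ((List.finRange d).flatMap fun i => List.replicate (β i) i).length = ∑ i, β i := by
  rw [List.length_flatMap]
  simp [Fin.sum_univ_def]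

lemma norm_multiDeriv_le (β : Fin d → ℕ) {f : RSpace d → ℂ} (hf : ContDiff ℝ ∞ f)
    (x : RSpace d) : ‖multiDeriv β f x‖ ≤ ‖iteratedFDeriv ℝ (∑ i, β i) f x‖ := by
  rw [multiDeriv_eq_listDeriv, listDeriv_eq_iteratedFDeriv _ hf, ← length_flat β]
  refine (ContinuousMultilinearMap.le_opNorm _ _).trans ?_
  simp

lemma norm_iteratedFDeriv_le_sum (n : ℕ) (f : RSpace d → ℂ) (x : RSpace d) :
    ‖iteratedFDeriv ℝ n f x‖ ≤ ∑ v : Fin n → Fin d,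
      ‖iteratedFDeriv ℝ n f x (fun j => EuclideanSpace.single (v j) (1 : ℝ))‖ := by
  refine ContinuousMultilinearMap.opNorm_le_bound (by positivity) fun m => ?_
  have hm : m = fun j => ∑ i, (m j i) • EuclideanSpace.single i (1 : ℝ) := by
    funext j
    ext k
    simp [Finset.sum_apply, Pi.single_apply]
  conv_lhs => rw [hm]
  rw [ContinuousMultilinearMap.map_sum]
  refine (norm_sum_le _ _).trans ?_
  rw [Finset.sum_mul]
  refine Finset.sum_le_sum fun v _ => ?_
  rw [ContinuousMultilinearMap.map_smul_univ, norm_smul, mul_comm]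
  refine mul_le_mul_of_nonneg_left ?_ (norm_nonneg _)
  rw [norm_prod]
  exact Finset.prod_le_prod (fun _ _ => norm_nonneg _) fun j _ => PiLp.norm_apply_le (m j) (v j)

lemma multiDeriv_count {n : ℕ} (v : Fin n → Fin d) {f : RSpace d → ℂ} (hf : ContDiff ℝ ∞ f)
    (x : RSpace d) :
    iteratedFDeriv ℝ n f x (fun j => EuclideanSpace.single (v j) (1 : ℝ)) =
      multiDeriv (fun i => (List.ofFn v).count i) f x := by
  rw [multiDeriv_eq_listDeriv]
  have hp : ((List.finRange d).flatMap
      fun i => List.replicate ((List.ofFn v).count i) i).Perm (List.ofFn v) := by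
    rw [List.perm_iff_count]
    intro a
    rw [List.count_flatMap]
    simp only [Function.comp_def, List.count_replicate]
    rw [← Fin.sum_univ_def]
    simp
  rw [listDeriv_perm hp hf, listDeriv_eq_iteratedFDeriv _ hf]
  have gen : ∀ (l : List (Fin d)) (hl : l.length = n),
      iteratedFDeriv ℝ n f x (fun j => EuclideanSpace.single (l.get (Fin.cast hl.symm j)) (1 : ℝ))
        = iteratedFDeriv ℝ l.length f x (fun j => EuclideanSpace.single (l.get j) (1 : ℝ)) := by
    intro l hl
    subst hl
    rfl
  rw [← gen (List.ofFn v) (by simp)]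
  simp

lemma sum_count_ofFn {n : ℕ} (v : Fin n → Fin d) : ∑ i, (List.ofFn v).count i = n := by
  have := Multiset.sum_count_eq_card (s := Finset.univ) (m := ((List.ofFn v : List (Fin d)) : Multiset (Fin d)))
    (fun a _ => Finset.mem_univ a)
  simpa using this

lemma multiFactorial_le (α : Fin d → ℕ) : multiFactorial α ≤ ((∑ i, α i)! : ℝ) := by
  unfold multiFactorial
  exact_mod_cast Nat.le_of_dvd (Nat.factorial_pos _)
    (Nat.prod_factorial_dvd_factorial_sum Finset.univ α)

lemma normEstimates_of_bddAbove {t s : ℝ} (ht : 0 < t) (hs : 0 < s) {f : RSpace d → ℂ}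
    (hf : ContDiff ℝ ∞ f) (H : ∀ h : ℝ, 0 < h → BddAbove (Set.range (gsQuotient t s h f))) :
    NormEstimates t s f := by
  intro h hh
  set D : ℝ := (d : ℝ) + 1 with hD
  have hD0 : 0 < D := by positivity
  obtain ⟨C, hC⟩ := H (h / D) (by positivity)
  have hest : ∀ (α β : Fin d → ℕ) (x : RSpace d),
      |monom α x| * ‖multiDeriv β f x‖ ≤ max C 0 * ((h / D) ^ (∑ i, α i + ∑ i, β i) *
        ((∑ i, α i)! : ℝ) ^ t * ((∑ i, β i)! : ℝ) ^ s) := by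
    intro α β x
    have h1 := hC ⟨(α, β, x), rfl⟩
    unfold gsQuotient at h1
    rw [div_le_iff₀ (gsDenom_pos (by positivity) _)] at h1
    simp only [norm_mul, Complex.norm_real, Real.norm_eq_abs, Finset.sum_add_distrib] at h1
    refine h1.trans ?_
    have := multiFactorial_pos α
    have := multiFactorial_pos β
    refine mul_le_mul (le_max_left _ _) ?_ (by positivity) (le_max_right _ _)
    gcongr
    · exact multiFactorial_le α
    · exact multiFactorial_le β
  refine ⟨max C 0, le_max_right _ _, fun k n x => ?_⟩
  -- a monomial dominating the power of the norm
  by_cases hk : ‖x‖ ^ k = 0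
  · rw [hk, zero_mul]; positivity
  have hmon : ∃ α : Fin d → ℕ, ∑ i, α i = k ∧ ‖x‖ ^ k ≤ D ^ k * |monom α x| := by
    rcases Nat.eq_zero_or_pos k with rfl | hk0
    · exact ⟨0, by simp [monom]⟩
    have hx : ‖x‖ ≠ 0 := fun h0 => hk (by rw [h0, zero_pow hk0.ne'])
    have hne : Nonempty (Fin d) := by
      by_contra hcon
      rw [not_nonempty_iff] at hcon
      exact hx (by simp [Subsingleton.elim x 0])
    obtain ⟨i, hi⟩ := Finite.exists_max (fun i => |x i|)
    refine ⟨Pi.single i k, by simp, ?_⟩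
    have hxi : ‖x‖ ≤ D * |x i| := by
      have h1 : x = ∑ j, (x j) • EuclideanSpace.single j (1 : ℝ) := by
        ext l
        simp [Finset.sum_apply, Pi.single_apply]
      calc ‖x‖ ≤ ∑ j, ‖(x j) • EuclideanSpace.single j (1 : ℝ)‖ := by
            conv_lhs => rw [h1]
            exact norm_sum_le _ _
        _ ≤ ∑ j : Fin d, |x i| := Finset.sum_le_sum fun j _ => by
            rw [norm_smul]; simpa using hi j
        _ = d * |x i| := by simp
        _ ≤ D * |x i| := mul_le_mul_of_nonneg_right (by linarith) (abs_nonneg _)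
    have hm : monom (Pi.single i k) x = x i ^ k := by
      unfold monom
      rw [Finset.prod_eq_single i]
      · simp
      · intro j _ hj
        simp [hj]
      · simp
    rw [hm, abs_pow, ← mul_pow]
    exact pow_le_pow_left₀ (norm_nonneg _) hxi k
  obtain ⟨α, hα, hαx⟩ := hmon
  calc ‖x‖ ^ k * ‖iteratedFDeriv ℝ n f x‖
      ≤ (D ^ k * |monom α x|) * ∑ v : Fin n → Fin d,
          ‖multiDeriv (fun i => (List.ofFn v).count i) f x‖ := by
        refine mul_le_mul hαx ?_ (norm_nonneg _) (by positivity)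
        simpa only [multiDeriv_count _ hf] using norm_iteratedFDeriv_le_sum n f x
    _ = D ^ k * ∑ v : Fin n → Fin d,
          |monom α x| * ‖multiDeriv (fun i => (List.ofFn v).count i) f x‖ := by
        rw [mul_assoc, Finset.mul_sum]
    _ ≤ D ^ k * ∑ v : Fin n → Fin d,
          max C 0 * ((h / D) ^ (k + n) * (k ! : ℝ) ^ t * (n ! : ℝ) ^ s) := by
        refine mul_le_mul_of_nonneg_left (Finset.sum_le_sum fun v _ => ?_) (by positivity)
        have := hest α (fun i => (List.ofFn v).count i) x
        rwa [hα, sum_count_ofFn] at this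
    _ = D ^ k * ((d : ℝ) ^ n * (max C 0 * ((h / D) ^ (k + n) * (k ! : ℝ) ^ t * (n ! : ℝ) ^ s))) := by
        simp
    _ ≤ D ^ k * (D ^ n * (max C 0 * ((h / D) ^ (k + n) * (k ! : ℝ) ^ t * (n ! : ℝ) ^ s))) := by
        gcongr
        linarith
    _ = max C 0 * (h ^ (k + n) * (k ! : ℝ) ^ t * (n ! : ℝ) ^ s) := by
        rw [div_pow, pow_add D]
        field_simp

lemma bddAbove_of_normEstimates {t s : ℝ} (ht : 0 < t) (hs : 0 < s) {f : RSpace d → ℂ}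
    (hf : ContDiff ℝ ∞ f) (H : NormEstimates t s f) (h : ℝ) (hh : 0 < h) :
    BddAbove (Set.range (gsQuotient t s h f)) := by
  set D : ℝ := (d : ℝ) + 1 with hD
  have hD1 : 1 ≤ D := by simp [hD]
  have hD0 : 0 < D := by positivity
  set A : ℝ := D ^ t * D ^ s with hA
  have hDt : 1 ≤ D ^ t := Real.one_le_rpow hD1 ht.le
  have hDs : 1 ≤ D ^ s := Real.one_le_rpow hD1 hs.le
  have hA0 : 0 < A := by positivity
  obtain ⟨C, hC0, hC⟩ := H (h / A) (by positivity)
  refine ⟨C, ?_⟩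
  rintro _ ⟨⟨α, β, x⟩, rfl⟩
  unfold gsQuotient
  rw [div_le_iff₀ (gsDenom_pos hh _)]
  simp only [norm_mul, Complex.norm_real, Real.norm_eq_abs, Finset.sum_add_distrib]
  set k := ∑ i, α i with hk
  set n := ∑ i, β i with hn
  have hα := multiFactorial_pos α
  have hβ := multiFactorial_pos β
  have hfac : ∀ (r : ℝ), 0 < r → ∀ γ : Fin d → ℕ,
      ((∑ i, γ i)! : ℝ) ^ r ≤ (D ^ r) ^ (∑ i, γ i) * multiFactorial γ ^ r := by
    intro r hr γ
    have h1 : ((∑ i, γ i)! : ℝ) ≤ D ^ (∑ i, γ i) * multiFactorial γ :=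
      (factorial_sum_le γ).trans (mul_le_mul_of_nonneg_right
        (pow_le_pow_left₀ (by positivity) (by linarith) _) (multiFactorial_pos γ).le)
    refine (Real.rpow_le_rpow (by positivity) h1 hr.le).trans_eq ?_
    rw [Real.mul_rpow (by positivity) (multiFactorial_pos γ).le]
    congr 1
    rw [← Real.rpow_natCast, ← Real.rpow_natCast, ← Real.rpow_mul hD0.le, ← Real.rpow_mul hD0.le,
      mul_comm]
  calc |monom α x| * ‖multiDeriv β f x‖ ≤ ‖x‖ ^ k * ‖iteratedFDeriv ℝ n f x‖ :=
        mul_le_mul (abs_monom_le α x) (norm_multiDeriv_le β hf x) (norm_nonneg _) (by positivity)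
    _ ≤ C * ((h / A) ^ (k + n) * (k ! : ℝ) ^ t * (n ! : ℝ) ^ s) := hC k n x
    _ ≤ C * ((h / A) ^ (k + n) * ((D ^ t) ^ k * multiFactorial α ^ t) *
          ((D ^ s) ^ n * multiFactorial β ^ s)) := by
        gcongr
        · exact hfac t ht α
        · exact hfac s hs β
    _ ≤ C * ((h / A) ^ (k + n) * (A ^ k * multiFactorial α ^ t) *
          (A ^ n * multiFactorial β ^ s)) := by
        gcongr
        · exact le_mul_of_one_le_right (by positivity) hDs
        · exact le_mul_of_one_le_left (by positivity) hDt
    _ = C * (h ^ (k + n) * multiFactorial α ^ t * multiFactorial β ^ s) := by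
        rw [div_pow, pow_add A]
        field_simp

lemma normEstimates_translate {t s : ℝ} (ht : 0 < t) {f : RSpace d → ℂ}
    (H : NormEstimates t s f) (a : RSpace d) : NormEstimates t s (fun y => f (y - a)) := by
  intro h hh
  obtain ⟨C, hC0, hC⟩ := H (h / 2) (by positivity)
  obtain ⟨B, hB0, hB⟩ := exists_pow_le ht (show 0 < h / 2 by positivity) (norm_nonneg a)
  refine ⟨(C + B * C), by positivity, fun k n x => ?_⟩
  rw [iteratedFDeriv_comp_sub]
  have hx : ‖x‖ ^ k ≤ 2 ^ k * (‖x - a‖ ^ k + ‖a‖ ^ k) := by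
    have h1 : ‖x‖ ≤ 2 * max ‖x - a‖ ‖a‖ := by
      have h2 : ‖x‖ ≤ ‖x - a‖ + ‖a‖ := by simpa using norm_add_le (x - a) a
      linarith [le_max_left ‖x - a‖ ‖a‖, le_max_right ‖x - a‖ ‖a‖]
    refine (pow_le_pow_left₀ (norm_nonneg _) h1 k).trans ?_
    rw [mul_pow]
    refine mul_le_mul_of_nonneg_left ?_ (by positivity)
    rcases max_choice ‖x - a‖ ‖a‖ with h3 | h3 <;> rw [h3]
    · exact le_add_of_nonneg_right (by positivity)
    · exact le_add_of_nonneg_left (by positivity)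
  have e1 := hC k n (x - a)
  have e2 := hC 0 n (x - a)
  simp only [pow_zero, one_mul, zero_add, Nat.factorial_zero, Nat.cast_one, Real.one_rpow,
    mul_one] at e2
  have e3 : ‖a‖ ^ k * ‖iteratedFDeriv ℝ n f (x - a)‖ ≤
      (B * ((h / 2) ^ k * (k ! : ℝ) ^ t)) * (C * ((h / 2) ^ n * (n ! : ℝ) ^ s)) :=
    mul_le_mul (hB k) e2 (norm_nonneg _) (by positivity)
  calc ‖x‖ ^ k * ‖iteratedFDeriv ℝ n f (x - a)‖
      ≤ 2 ^ k * (‖x - a‖ ^ k + ‖a‖ ^ k) * ‖iteratedFDeriv ℝ n f (x - a)‖ :=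
        mul_le_mul_of_nonneg_right hx (norm_nonneg _)
    _ = 2 ^ k * (‖x - a‖ ^ k * ‖iteratedFDeriv ℝ n f (x - a)‖
          + ‖a‖ ^ k * ‖iteratedFDeriv ℝ n f (x - a)‖) := by ring
    _ ≤ 2 ^ k * (C * ((h / 2) ^ (k + n) * (k ! : ℝ) ^ t * (n ! : ℝ) ^ s) +
          (B * ((h / 2) ^ k * (k ! : ℝ) ^ t)) * (C * ((h / 2) ^ n * (n ! : ℝ) ^ s))) := by
        gcongr
    _ = 2 ^ k * ((C + B * C) * ((h / 2) ^ (k + n) * (k ! : ℝ) ^ t * (n ! : ℝ) ^ s)) := by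
        ring
    _ ≤ 2 ^ (k + n) * ((C + B * C) * ((h / 2) ^ (k + n) * (k ! : ℝ) ^ t * (n ! : ℝ) ^ s)) := by
        gcongr
        · norm_num
        · omega
    _ = (C + B * C) * (h ^ (k + n) * (k ! : ℝ) ^ t * (n ! : ℝ) ^ s) := by
        rw [div_pow]
        field_simp

/-- The character `y ↦ e^{i⟨y, ξ⟩}`. -/
def character (ξ : RSpace d) (y : RSpace d) : ℂ :=
  Complex.exp (Complex.I * ((inner ℝ y ξ : ℝ) : ℂ))

lemma contDiff_expI : ContDiff ℝ ∞ (fun r : ℝ => Complex.exp (Complex.I * (r : ℂ))) :=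
  (contDiff_const.mul Complex.ofRealCLM.contDiff).cexp

lemma character_eq_comp (ξ : RSpace d) :
    character ξ = (fun r : ℝ => Complex.exp (Complex.I * (r : ℂ))) ∘ (innerSL ℝ ξ) := by
  funext y
  simp [character, real_inner_comm]

lemma contDiff_character (ξ : RSpace d) : ContDiff ℝ ∞ (character ξ) := by
  rw [character_eq_comp]
  exact contDiff_expI.comp (innerSL ℝ ξ).contDiff

lemma iteratedDeriv_expI (n : ℕ) (r : ℝ) :
    iteratedDeriv n (fun r : ℝ => Complex.exp (Complex.I * (r : ℂ))) r =
      Complex.I ^ n * Complex.exp (Complex.I * (r : ℂ)) := by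
  induction n generalizing r with
  | zero => simp
  | succ n ih =>
    rw [iteratedDeriv_succ, funext ih]
    have h1 : HasDerivAt (fun r : ℝ => Complex.exp (Complex.I * (r : ℂ)))
        (Complex.exp (Complex.I * (r : ℂ)) * (Complex.I * 1)) r :=
      ((Complex.ofRealCLM.hasDerivAt (x := r)).const_mul Complex.I).cexp
    rw [(h1.const_mul (Complex.I ^ n)).deriv]
    ring

lemma norm_iteratedFDeriv_character_le (ξ : RSpace d) (n : ℕ) (x : RSpace d) :
    ‖iteratedFDeriv ℝ n (character ξ) x‖ ≤ ‖ξ‖ ^ n := by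
  rw [character_eq_comp, ContinuousLinearMap.iteratedFDeriv_comp_right (innerSL ℝ ξ) contDiff_expI x
    (i := n) (WithTop.coe_le_coe.2 le_top)]
  refine (ContinuousMultilinearMap.norm_compContinuousLinearMap_le _ _).trans ?_
  rw [norm_iteratedFDeriv_eq_norm_iteratedDeriv, iteratedDeriv_expI, norm_mul,
    mul_comm Complex.I, Complex.norm_exp_ofReal_mul_I]
  simp

lemma normEstimates_modulate {t s : ℝ} (hs : 0 < s) {f : RSpace d → ℂ}
    (hf : ContDiff ℝ ∞ f) (H : NormEstimates t s f) (ξ : RSpace d) :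
    NormEstimates t s (fun y => character ξ y * f y) := by
  intro h hh
  obtain ⟨C, hC0, hC⟩ := H (h / 2) (by positivity)
  obtain ⟨B, hB0, hB⟩ := exists_pow_le hs (show 0 < h / 2 by positivity) (norm_nonneg ξ)
  refine ⟨B * C, by positivity, fun k n x => ?_⟩
  have hL := norm_iteratedFDeriv_mul_le (contDiff_character ξ) hf x (n := n)
    (WithTop.coe_le_coe.2 le_top)
  have hterm : ∀ i ∈ Finset.range (n + 1),
      ‖x‖ ^ k * ((n.choose i : ℝ) * ‖iteratedFDeriv ℝ i (character ξ) x‖ *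
        ‖iteratedFDeriv ℝ (n - i) f x‖) ≤
      (n.choose i : ℝ) * (B * C * ((h / 2) ^ (k + n) * (k ! : ℝ) ^ t * (n ! : ℝ) ^ s)) := by
    intro i hi
    have hin : i ≤ n := Nat.lt_succ_iff.1 (Finset.mem_range.1 hi)
    have e1 := (norm_iteratedFDeriv_character_le ξ i x).trans (hB i)
    have e2 := hC k (n - i) x
    have e3 := mul_le_mul e1 e2 (by positivity) (by positivity)
    have e4 : (i ! : ℝ) ^ s * ((n - i)! : ℝ) ^ s ≤ (n ! : ℝ) ^ s := by
      rw [← Real.mul_rpow (by positivity) (by positivity)]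
      refine Real.rpow_le_rpow (by positivity) ?_ hs.le
      exact_mod_cast Nat.le_of_dvd (Nat.factorial_pos _)
        (Nat.factorial_mul_factorial_dvd_factorial hin)
    calc ‖x‖ ^ k * ((n.choose i : ℝ) * ‖iteratedFDeriv ℝ i (character ξ) x‖ *
            ‖iteratedFDeriv ℝ (n - i) f x‖)
        = (n.choose i : ℝ) * (‖iteratedFDeriv ℝ i (character ξ) x‖ *
            (‖x‖ ^ k * ‖iteratedFDeriv ℝ (n - i) f x‖)) := by ring
      _ ≤ (n.choose i : ℝ) * (B * ((h / 2) ^ i * (i ! : ℝ) ^ s) *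
            (C * ((h / 2) ^ (k + (n - i)) * (k ! : ℝ) ^ t * ((n - i)! : ℝ) ^ s))) :=
          mul_le_mul_of_nonneg_left e3 (by positivity)
      _ = (n.choose i : ℝ) * (B * C * ((h / 2) ^ (i + (k + (n - i))) * (k ! : ℝ) ^ t *
            ((i ! : ℝ) ^ s * ((n - i)! : ℝ) ^ s))) := by
          rw [pow_add (h / 2) i]
          ring
      _ ≤ _ := by
          rw [show i + (k + (n - i)) = k + n by omega]
          gcongr
  have hsum : ∑ i ∈ Finset.range (n + 1), (n.choose i : ℝ) = 2 ^ n := by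
    exact_mod_cast Nat.sum_range_choose n
  calc ‖x‖ ^ k * ‖iteratedFDeriv ℝ n (fun y => character ξ y * f y) x‖
      ≤ ∑ i ∈ Finset.range (n + 1), ‖x‖ ^ k * ((n.choose i : ℝ) *
          ‖iteratedFDeriv ℝ i (character ξ) x‖ * ‖iteratedFDeriv ℝ (n - i) f x‖) := by
        rw [← Finset.mul_sum]
        exact mul_le_mul_of_nonneg_left hL (by positivity)
    _ ≤ 2 ^ n * (B * C * ((h / 2) ^ (k + n) * (k ! : ℝ) ^ t * (n ! : ℝ) ^ s)) := by
        rw [← hsum, Finset.sum_mul]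
        exact Finset.sum_le_sum hterm
    _ ≤ 2 ^ (k + n) * (B * C * ((h / 2) ^ (k + n) * (k ! : ℝ) ^ t * (n ! : ℝ) ^ s)) := by
        gcongr
        · norm_num
        · omega
    _ = B * C * (h ^ (k + n) * (k ! : ℝ) ^ t * (n ! : ℝ) ^ s) := by
        rw [div_pow]
        field_simp

end Spaces

section WaveFront

open scoped ContDiff

/-- The time-frequency shift `M_ξ T_x φ(y) = e^{i⟨y, ξ⟩} φ(y - x)`, as an element of
`Σ_t^s(ℝ^d)`. -/
def timeFreqShift {t s : ℝ} (ht : 0 < t) (hs : 0 < s) (x ξ : RSpace d) (φ : GSSpace d t s) :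
    GSSpace d t s :=
  ⟨fun y => Complex.exp (Complex.I * ((inner ℝ y ξ : ℝ) : ℂ)) * φ (y - x), by
    have h1 : ContDiff ℝ ∞ (fun y => φ.toFun (y - x)) :=
      φ.contDiff.comp (contDiff_id.sub contDiff_const)
    have h2 : ContDiff ℝ ∞ (fun y => character ξ y * φ.toFun (y - x)) :=
      (contDiff_character ξ).mul h1
    exact ⟨h2, bddAbove_of_normEstimates ht hs h2 (normEstimates_modulate hs h1
      (normEstimates_translate ht (normEstimates_of_bddAbove ht hs φ.contDiff
        fun _ hh => φ.bddAbove hh) x) ξ)⟩⟩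

/-! ### The short-time Fourier transform and the wave front set -/

/-- The short-time Fourier transform `V_φ u(x, ξ) = (2π)^{-d/2} (u, M_ξ T_x φ)`. -/
def stft {t s : ℝ} (ht : 0 < t) (hs : 0 < s) (φ : GSSpace d t s) (u : GSDual d t s)
    (z : PhaseSpace d) : ℂ :=
  (((2 * Real.pi) ^ (-((d : ℝ) / 2)) : ℝ) : ℂ) * u (timeFreqShift ht hs z.1 z.2 φ)

/-- The condition
`sup_{λ > 0, (x,ξ) ∈ U} e^{rλ} |V_ψ u(λ^t x, λ^s ξ)| < ∞` for all `r > 0`. -/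
def SuperExpDecay {t s : ℝ} (ht : 0 < t) (hs : 0 < s) (ψ : GSSpace d t s) (u : GSDual d t s)
    (U : Set (PhaseSpace d)) : Prop :=
  ∀ r : ℝ, 0 < r → ∃ C : ℝ, ∀ l : ℝ, 0 < l → ∀ z ∈ U,
    Real.exp (r * l) * ‖stft ht hs ψ u (l ^ t • z.1, l ^ s • z.2)‖ ≤ C

/-- The wave front set `WF^{t,s}(u) ⊆ T^*ℝ^d ∖ 0`, computed with the window `ψ`. -/
def waveFrontSet {t s : ℝ} (ht : 0 < t) (hs : 0 < s) (ψ : GSSpace d t s) (u : GSDual d t s) :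
    Set (PhaseSpace d) :=
  {z | z ≠ 0 ∧ ¬ ∃ U : Set (PhaseSpace d),
    IsOpen U ∧ U ⊆ {0}ᶜ ∧ z ∈ U ∧ SuperExpDecay ht hs ψ u U}

end WaveFront

end GelfandShilov

end

noncomputable section

namespace GelfandShilov

variable {d : ℕ}

section Estimates

open scoped ContDiff Nat

/-! ### Powers and exponentials -/

/-! Write N(x, ξ) = |x|^{1/t} + |ξ|^{1/s}. Since ψ ≠ 0, Fourier inversion reproduces every φ as a
superposition of time-frequency shifts of ψ (`integral_windowCoeff_mul`), with coefficients that are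
O(e^{-rN}) for every r (`exists_norm_windowCoeff_le`). Shifting this identity by z and applying u
gives |V_φ u(z)| ≤ ∫ c(w) |V_ψ u(z + w)| dw, up to a rescaling of the frequency, with a kernel c
that does not depend on z and beats every e^{-rN} (`exists_norm_stft_le_integral`).

The weight N is homogeneous of degree one under (x, ξ) ↦ (λ^t x, λ^s ξ). If z is the dilate by λ of
a point near z₀, the integral is split at N(w) = ελ. Where N(w) ≤ ελ, the point z + w is still the
dilate of a point of U, and the hypothesis supplies e^{-ρλ}. Where N(w) > ελ, V_ψ u grows at most
like e^{rN} (`exists_norm_stft_le`), and the decay of c pays for this growth and for e^{-ρλ}. This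
is `SuperExpDecay.exists_change_window`; the equality of wave front sets follows on exchanging the
windows.

Moving u under the integral is the functional analytic point (`GSDual.apply_eq_integral`). The
functional is bounded by a single seminorm, and that seminorm embeds the space into a Banach space
of bounded families. Hahn–Banach extends the conjugate of u there, and Bochner integrals commute
with the extension. Continuity and growth of the shifts in the Fréchet topology are obtained by
tracking constants in `ExpBound`. -/

lemma add_rpow_inv_le {t : ℝ} (ht : 0 < t) {a b : ℝ} (ha : 0 ≤ a) (hb : 0 ≤ b) :
    (a + b) ^ t⁻¹ ≤ 2 ^ t⁻¹ * (a ^ t⁻¹ + b ^ t⁻¹) := by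
  have ht' : 0 ≤ t⁻¹ := (inv_pos.2 ht).le
  have key : ∀ x y : ℝ, 0 ≤ x → x ≤ y → (x + y) ^ t⁻¹ ≤ 2 ^ t⁻¹ * (x ^ t⁻¹ + y ^ t⁻¹) := by
    intro x y hx hxy
    have hy : 0 ≤ y := hx.trans hxy
    calc (x + y) ^ t⁻¹ ≤ (2 * y) ^ t⁻¹ :=
          Real.rpow_le_rpow (by positivity) (by linarith) ht'
      _ = 2 ^ t⁻¹ * y ^ t⁻¹ := Real.mul_rpow (by norm_num) hy
      _ ≤ _ := mul_le_mul_of_nonneg_left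
          (le_add_of_nonneg_left (Real.rpow_nonneg hx _)) (by positivity)
  rcases le_total a b with h | h
  · exact key a b ha h
  · rw [add_comm a b, add_comm (a ^ t⁻¹)]
    exact key b a hb h

/-- Take b^k ≤ e^b k! with b = (r/t) a^{1/t} and raise it to the power t: the exponential becomes
e^{r a^{1/t}}. -/
lemma pow_le_exp_mul_factorial_rpow {t r : ℝ} (ht : 0 < t) (hr : 0 < r) {a : ℝ} (ha : 0 ≤ a)
    (k : ℕ) : a ^ k ≤ Real.exp (r * a ^ t⁻¹) * (((t / r) ^ t) ^ k * (k ! : ℝ) ^ t) := by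
  have hb0 : 0 ≤ r / t * a ^ t⁻¹ := by positivity
  have h1 : (r / t * a ^ t⁻¹) ^ k ≤ Real.exp (r / t * a ^ t⁻¹) * k ! :=
    (div_le_iff₀ (by positivity)).1 (Real.pow_div_factorial_le_exp _ hb0 k)
  have h2 := Real.rpow_le_rpow (pow_nonneg hb0 k) h1 ht.le
  rw [Real.mul_rpow (Real.exp_pos _).le (by positivity), ← Real.exp_mul] at h2
  have e1 : r / t * a ^ t⁻¹ * t = r * a ^ t⁻¹ := by field_simp
  have e2 : ((r / t * a ^ t⁻¹) ^ k) ^ t = ((r / t) ^ t) ^ k * a ^ k := by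
    rw [← Real.rpow_natCast, ← Real.rpow_mul hb0, mul_comm (k : ℝ) t, Real.rpow_mul hb0,
      Real.mul_rpow (by positivity) (by positivity), ← Real.rpow_mul ha, inv_mul_cancel₀ ht.ne',
      Real.rpow_one, Real.rpow_natCast, mul_pow]
  have e3 : ((t / r) ^ t) ^ k * ((r / t) ^ t) ^ k = 1 := by
    rw [← mul_pow, ← Real.mul_rpow (by positivity) (by positivity), div_mul_div_cancel₀ hr.ne',
      div_self ht.ne', Real.one_rpow, one_pow]
  rw [e1, e2] at h2
  calc a ^ k = ((t / r) ^ t) ^ k * (((r / t) ^ t) ^ k * a ^ k) := by rw [← mul_assoc, e3, one_mul]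
    _ ≤ ((t / r) ^ t) ^ k * (Real.exp (r * a ^ t⁻¹) * (k ! : ℝ) ^ t) :=
        mul_le_mul_of_nonneg_left h2 (by positivity)
    _ = _ := by ring

/-- The rate r = t / h^{1/t} is the one for which (t/r)^t = h. -/
lemma pow_le_exp_div_rpow_mul {t h : ℝ} (ht : 0 < t) (hh : 0 < h) {a : ℝ} (ha : 0 ≤ a) (k : ℕ) :
    a ^ k ≤ Real.exp (t / h ^ t⁻¹ * a ^ t⁻¹) * (h ^ k * (k ! : ℝ) ^ t) := by
  have := pow_le_exp_mul_factorial_rpow ht (r := t / h ^ t⁻¹) (by positivity) ha k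
  rwa [div_div_cancel₀ ht.ne', ← Real.rpow_mul hh.le, inv_mul_cancel₀ ht.ne', Real.rpow_one]
    at this

/-- Converse direction, from powers to exponentials. Take roots of order t in `H`, multiply by
(r/t)^k / k! and sum over k. The left side becomes the exponential series of (r/t) a^{1/t}; the 2r
in the hypothesis leaves a geometric series of ratio 1/2 on the right, whose sum 2 becomes 2^t after
returning to the power t. -/
lemma mul_exp_le_of_forall_pow_le {t r Q M a : ℝ} (ht : 0 < t) (hr : 0 < r) (hQ : 0 ≤ Q)
    (hM : 0 ≤ M) (ha : 0 ≤ a)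
    (H : ∀ k : ℕ, Q * a ^ k ≤ M * (((t / (2 * r)) ^ t) ^ k * (k ! : ℝ) ^ t)) :
    Q * Real.exp (r * a ^ t⁻¹) ≤ 2 ^ t * M := by
  set b : ℝ := r / t * a ^ t⁻¹ with hb
  have hb0 : 0 ≤ b := by positivity
  have hti : 0 ≤ t⁻¹ := by positivity
  have hroot : ∀ x : ℝ, 0 ≤ x → (x ^ t) ^ t⁻¹ = x := fun x hx => Real.rpow_rpow_inv hx ht.ne'
  have hpow : ∀ (x : ℝ) (k : ℕ), 0 ≤ x → (x ^ k) ^ t⁻¹ = (x ^ t⁻¹) ^ k := by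
    intro x k hx
    rw [← Real.rpow_natCast, ← Real.rpow_mul hx, mul_comm, Real.rpow_mul hx, Real.rpow_natCast]
  have h1 : ∀ k : ℕ, Q ^ t⁻¹ * (b ^ k / k !) ≤ M ^ t⁻¹ * (1 / 2) ^ k := by
    intro k
    have h2 := Real.rpow_le_rpow (by positivity) (H k) hti
    rw [Real.mul_rpow hQ (by positivity), Real.mul_rpow hM (by positivity),
      Real.mul_rpow (by positivity) (by positivity), hroot _ (by positivity), hpow _ _ ha,
      hpow _ _ (by positivity), hroot _ (by positivity)] at h2
    have e : b ^ k / k ! = (a ^ t⁻¹) ^ k * ((r / t) ^ k / k !) := by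
      rw [hb, mul_pow]; ring
    rw [e, ← mul_assoc]
    calc Q ^ t⁻¹ * (a ^ t⁻¹) ^ k * ((r / t) ^ k / k !)
        ≤ M ^ t⁻¹ * ((t / (2 * r)) ^ k * (k ! : ℝ)) * ((r / t) ^ k / k !) :=
          mul_le_mul_of_nonneg_right h2 (by positivity)
      _ = M ^ t⁻¹ * (t / (2 * r) * (r / t)) ^ k := by
          rw [mul_pow]; field_simp
      _ = _ := by congr 2; field_simp
  have hs1 : HasSum (fun k : ℕ => Q ^ t⁻¹ * (b ^ k / k !)) (Q ^ t⁻¹ * Real.exp b) := by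
    rw [Real.exp_eq_exp_ℝ]
    exact (NormedSpace.expSeries_div_hasSum_exp b).mul_left _
  have hs2 : HasSum (fun k : ℕ => M ^ t⁻¹ * (1 / 2 : ℝ) ^ k) (M ^ t⁻¹ * 2) :=
    hasSum_geometric_two.mul_left _
  have h3 := Real.rpow_le_rpow (by positivity) (hasSum_le h1 hs1 hs2) ht.le
  rw [Real.mul_rpow (by positivity) (by positivity), Real.mul_rpow (by positivity) (by norm_num),
    Real.rpow_inv_rpow hQ ht.ne', Real.rpow_inv_rpow hM ht.ne', ← Real.exp_mul] at h3
  have e : b * t = r * a ^ t⁻¹ := by rw [hb]; field_simp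
  rw [e] at h3
  linarith

/-- Bernoulli's inequality with base 1 + q = 2^{1/s}, whose s-th power is 2. It absorbs the factor
(n + 1)^s that appears when one extra derivative is spent. -/
lemma exists_succ_rpow_le {s : ℝ} (hs : 0 < s) :
    ∃ K : ℝ, 0 < K ∧ ∀ n : ℕ, ((n : ℝ) + 1) ^ s ≤ K * 2 ^ n := by
  have h2 : (0 : ℝ) < 2 ^ s⁻¹ - 1 := by
    have : (1 : ℝ) < 2 ^ s⁻¹ := Real.one_lt_rpow (by norm_num) (by positivity)
    linarith
  set q : ℝ := 2 ^ s⁻¹ - 1 with hq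
  refine ⟨(1 + 1 / q) ^ s, by positivity, fun n => ?_⟩
  have hB : 1 + (n : ℝ) * q ≤ (1 + q) ^ n := one_add_mul_le_pow (by linarith) n
  have h1 : (n : ℝ) + 1 ≤ (1 + 1 / q) * (1 + q) ^ n := by
    have h3 : (1 : ℝ) ≤ (1 + q) ^ n := one_le_pow₀ (by linarith)
    have h4 : (n : ℝ) ≤ (1 + q) ^ n / q := by
      rw [le_div_iff₀ h2]; linarith
    calc (n : ℝ) + 1 ≤ (1 + q) ^ n / q + (1 + q) ^ n := add_le_add h4 h3
      _ = _ := by ring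
  refine (Real.rpow_le_rpow (by positivity) h1 hs.le).trans_eq ?_
  rw [Real.mul_rpow (by positivity) (by positivity)]
  congr 1
  have h5 : (0 : ℝ) ≤ 1 + q := by linarith
  rw [← Real.rpow_natCast, ← Real.rpow_mul h5, mul_comm, Real.rpow_mul h5, Real.rpow_natCast, hq,
    add_sub_cancel, Real.rpow_inv_rpow (by norm_num) hs.ne']

lemma factorial_rpow_mul_le {s : ℝ} (hs : 0 < s) {i n : ℕ} (hin : i ≤ n) :
    (i ! : ℝ) ^ s * ((n - i)! : ℝ) ^ s ≤ (n ! : ℝ) ^ s := by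
  rw [← Real.mul_rpow (by positivity) (by positivity)]
  refine Real.rpow_le_rpow (by positivity) ?_ hs.le
  exact_mod_cast Nat.le_of_dvd (Nat.factorial_pos _)
    (Nat.factorial_mul_factorial_dvd_factorial hin)

lemma exists_one_add_pow_le_exp {t : ℝ} (ht : 0 < t) (m : ℕ) :
    ∃ K : ℝ, 0 < K ∧ ∀ a : ℝ, 0 ≤ a → (1 + a) ^ m ≤ K * Real.exp (a ^ t⁻¹) := by
  refine ⟨2 ^ m * (1 + ((t / 1) ^ t) ^ m * (m ! : ℝ) ^ t), by positivity, fun a ha => ?_⟩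
  have h1 := pow_le_exp_mul_factorial_rpow ht one_pos ha m
  rw [one_mul] at h1
  have h2 : (1 : ℝ) ≤ Real.exp (a ^ t⁻¹) := Real.one_le_exp (by positivity)
  have h3 : (1 + a) ^ m ≤ 2 ^ m * (1 + a ^ m) := by
    rcases le_total a 1 with h | h
    · calc (1 + a) ^ m ≤ 2 ^ m := pow_le_pow_left₀ (by positivity) (by linarith) m
        _ ≤ _ := le_mul_of_one_le_right (by positivity) (le_add_of_nonneg_right (by positivity))
    · calc (1 + a) ^ m ≤ (2 * a) ^ m := pow_le_pow_left₀ (by positivity) (by linarith) m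
        _ = 2 ^ m * a ^ m := mul_pow _ _ _
        _ ≤ _ := by gcongr; linarith
  refine h3.trans ?_
  rw [mul_assoc]
  refine mul_le_mul_of_nonneg_left ?_ (by positivity)
  linarith

/-! ### Exponential form of the Gelfand–Shilov estimates -/

/-- `|D^n f(x)| ≤ C h^n n!^s e^{-r |x|^{1/t}}` for all `n` and `x`. -/
def ExpBound (t s h r C : ℝ) (f : RSpace d → ℂ) : Prop :=
  ∀ (n : ℕ) (x : RSpace d), ‖iteratedFDeriv ℝ n f x‖ ≤
    C * (h ^ n * (n ! : ℝ) ^ s) * Real.exp (-(r * ‖x‖ ^ t⁻¹))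

lemma exists_expBound_of_normEstimates {t s : ℝ} (ht : 0 < t) {f : RSpace d → ℂ}
    (H : NormEstimates t s f) {h r : ℝ} (hh : 0 < h) (hr : 0 < r) :
    ∃ C : ℝ, 0 ≤ C ∧ ExpBound t s h r C f := by
  -- The estimates have a single parameter for powers and derivatives: h serves the derivatives, the
  -- other value is what summation over k requires.
  set g : ℝ := min h ((t / (2 * r)) ^ t) with hg
  have hg0 : 0 < g := lt_min hh (by positivity)
  obtain ⟨C, hC0, hC⟩ := H g hg0
  refine ⟨2 ^ t * C, by positivity, fun n x => ?_⟩
  have h1 := mul_exp_le_of_forall_pow_le (Q := ‖iteratedFDeriv ℝ n f x‖)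
    (M := C * (h ^ n * (n ! : ℝ) ^ s)) ht hr (norm_nonneg _) (by positivity) (norm_nonneg x)
    fun k => by
      rw [mul_comm]
      refine (hC k n x).trans ?_
      rw [pow_add]
      calc C * (g ^ k * g ^ n * (k ! : ℝ) ^ t * (n ! : ℝ) ^ s)
          ≤ C * (((t / (2 * r)) ^ t) ^ k * h ^ n * (k ! : ℝ) ^ t * (n ! : ℝ) ^ s) := by
            gcongr
            · exact min_le_right _ _
            · exact min_le_left _ _
        _ = _ := by ring
  rw [Real.exp_neg, ← div_eq_mul_inv, le_div_iff₀ (Real.exp_pos _)]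
  linarith

lemma GSSpace.normEstimates {t s : ℝ} (ht : 0 < t) (hs : 0 < s) (f : GSSpace d t s) :
    NormEstimates t s f.toFun :=
  normEstimates_of_bddAbove ht hs f.contDiff fun _ hh => f.bddAbove hh

lemma GSSpace.exists_expBound {t s : ℝ} (ht : 0 < t) (hs : 0 < s) (f : GSSpace d t s) {h r : ℝ}
    (hh : 0 < h) (hr : 0 < r) : ∃ C : ℝ, 0 ≤ C ∧ ExpBound t s h r C f.toFun :=
  exists_expBound_of_normEstimates ht (f.normEstimates ht hs) hh hr

/-- The inequality |γ|! ≤ d^{|γ|} γ! makes the passage to multi-indices cost only a fixed factor in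
h. The constant C is unchanged, so smallness passes to the seminorm. -/
lemma gsQuotient_le_of_forall_norm_le {t s h C : ℝ} (ht : 0 < t) (hs : 0 < s) (hh : 0 < h)
    (hC0 : 0 ≤ C) {f : RSpace d → ℂ} (hf : ContDiff ℝ ∞ f)
    (hC : ∀ (k n : ℕ) (x : RSpace d), ‖x‖ ^ k * ‖iteratedFDeriv ℝ n f x‖ ≤
      C * ((h / (((d : ℝ) + 1) ^ t * ((d : ℝ) + 1) ^ s)) ^ (k + n) * (k ! : ℝ) ^ t *
        (n ! : ℝ) ^ s)) (p : (Fin d → ℕ) × (Fin d → ℕ) × RSpace d) :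
    gsQuotient t s h f p ≤ C := by
  obtain ⟨α, β, x⟩ := p
  set D : ℝ := (d : ℝ) + 1 with hD
  have hD1 : 1 ≤ D := by simp [hD]
  have hD0 : 0 < D := by positivity
  set A : ℝ := D ^ t * D ^ s with hA
  have hDt : 1 ≤ D ^ t := Real.one_le_rpow hD1 ht.le
  have hDs : 1 ≤ D ^ s := Real.one_le_rpow hD1 hs.le
  have hA0 : 0 < A := by positivity
  unfold gsQuotient
  rw [div_le_iff₀ (gsDenom_pos hh _)]
  simp only [norm_mul, Complex.norm_real, Real.norm_eq_abs, Finset.sum_add_distrib]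
  set k := ∑ i, α i with hk
  set n := ∑ i, β i with hn
  have hα := multiFactorial_pos α
  have hβ := multiFactorial_pos β
  have hfac : ∀ (r : ℝ), 0 < r → ∀ γ : Fin d → ℕ,
      ((∑ i, γ i)! : ℝ) ^ r ≤ (D ^ r) ^ (∑ i, γ i) * multiFactorial γ ^ r := by
    intro r hr γ
    have h1 : ((∑ i, γ i)! : ℝ) ≤ D ^ (∑ i, γ i) * multiFactorial γ :=
      (factorial_sum_le γ).trans (mul_le_mul_of_nonneg_right
        (pow_le_pow_left₀ (by positivity) (by linarith) _) (multiFactorial_pos γ).le)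
    refine (Real.rpow_le_rpow (by positivity) h1 hr.le).trans_eq ?_
    rw [Real.mul_rpow (by positivity) (multiFactorial_pos γ).le]
    congr 1
    rw [← Real.rpow_natCast, ← Real.rpow_natCast, ← Real.rpow_mul hD0.le, ← Real.rpow_mul hD0.le,
      mul_comm]
  calc |monom α x| * ‖multiDeriv β f x‖ ≤ ‖x‖ ^ k * ‖iteratedFDeriv ℝ n f x‖ :=
        mul_le_mul (abs_monom_le α x) (norm_multiDeriv_le β hf x) (norm_nonneg _) (by positivity)
    _ ≤ C * ((h / A) ^ (k + n) * (k ! : ℝ) ^ t * (n ! : ℝ) ^ s) := hC k n x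
    _ ≤ C * ((h / A) ^ (k + n) * ((D ^ t) ^ k * multiFactorial α ^ t) *
          ((D ^ s) ^ n * multiFactorial β ^ s)) := by
        gcongr
        · exact hfac t ht α
        · exact hfac s hs β
    _ ≤ C * ((h / A) ^ (k + n) * (A ^ k * multiFactorial α ^ t) *
          (A ^ n * multiFactorial β ^ s)) := by
        gcongr
        · exact le_mul_of_one_le_right (by positivity) hDs
        · exact le_mul_of_one_le_left (by positivity) hDt
    _ = C * (h ^ (k + n) * multiFactorial α ^ t * multiFactorial β ^ s) := by
        rw [div_pow, pow_add A]
        field_simp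

/-- The parameters g and r depend on h but not on f, and C survives unchanged. Growth and continuity
in the Fréchet topology thus reduce to following the constant in `ExpBound`. -/
lemma exists_gsSeminorm_le_of_expBound {t s : ℝ} (ht : 0 < t) (hs : 0 < s)
    (h : Set.Ioi (0 : ℝ)) : ∃ g r : ℝ, 0 < g ∧ 0 < r ∧ ∀ (C : ℝ) (f : GSSpace d t s), 0 ≤ C →
      ExpBound t s g r C f.toFun → gsSeminorm d t s h f ≤ C := by
  set A : ℝ := ((d : ℝ) + 1) ^ t * ((d : ℝ) + 1) ^ s with hA
  have hA0 : 0 < A := by positivity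
  have hh : 0 < h.1 := h.2
  have hg : 0 < h.1 / A := by positivity
  refine ⟨h.1 / A, t / (h.1 / A) ^ t⁻¹, hg, by positivity, fun C f hC0 hC => ?_⟩
  refine ciSup_le fun p => gsQuotient_le_of_forall_norm_le ht hs h.2 hC0 f.contDiff
    (fun k n x => ?_) p
  have h1 := pow_le_exp_div_rpow_mul ht hg (norm_nonneg x) k
  have h2 := mul_le_mul h1 (hC n x) (norm_nonneg _) (by positivity)
  refine h2.trans_eq ?_
  rw [Real.exp_neg, pow_add, ← hA]
  field_simp

/-! ### Time-frequency shifts -/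

/-- The power 1/t is subadditive only up to the factor 2^{1/t}, so each translation divides the
decay rate by 2^{1/t}. -/
lemma exp_neg_rpow_sub_le {t r : ℝ} (ht : 0 < t) (hr : 0 ≤ r) (x a : RSpace d) :
    Real.exp (-(r * 2 ^ t⁻¹ * ‖x - a‖ ^ t⁻¹)) ≤
      Real.exp (r * 2 ^ t⁻¹ * ‖a‖ ^ t⁻¹) * Real.exp (-(r * ‖x‖ ^ t⁻¹)) := by
  rw [← Real.exp_add, Real.exp_le_exp]
  have h1 : ‖x‖ ≤ ‖x - a‖ + ‖a‖ := by simpa using norm_add_le (x - a) a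
  have h2 := (Real.rpow_le_rpow (norm_nonneg _) h1 (inv_pos.2 ht).le).trans
    (add_rpow_inv_le ht (norm_nonneg _) (norm_nonneg _))
  nlinarith [mul_le_mul_of_nonneg_left h2 hr]

lemma ExpBound.translate {t s h r C : ℝ} (ht : 0 < t) (hh : 0 ≤ h) (hr : 0 ≤ r) (hC : 0 ≤ C)
    {f : RSpace d → ℂ} (H : ExpBound t s h (r * 2 ^ t⁻¹) C f) (a : RSpace d) :
    ExpBound t s h r (C * Real.exp (r * 2 ^ t⁻¹ * ‖a‖ ^ t⁻¹)) (fun y => f (y - a)) := by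
  intro n x
  rw [iteratedFDeriv_comp_sub]
  refine (H n (x - a)).trans ((mul_le_mul_of_nonneg_left (exp_neg_rpow_sub_le ht hr x a)
    (by positivity)).trans_eq ?_)
  ring

/-- Leibniz' rule with i! (n - i)! ≤ n!; the binomial coefficients sum to 2^n, which doubles h. The
factor g is controlled only at the point x, so r' may depend on x: this covers characters, factors
of polynomial growth and translated windows alike. -/
lemma ExpBound.mul {t s h r r' C C' : ℝ} (hs : 0 < s) (hh : 0 ≤ h) (hC : 0 ≤ C)
    {f g : RSpace d → ℂ} (hf : ContDiff ℝ ∞ f) (hg : ContDiff ℝ ∞ g) (Hf : ExpBound t s h r C f)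
    {x : RSpace d}
    (Hg : ∀ n, ‖iteratedFDeriv ℝ n g x‖ ≤ C' * (h ^ n * (n ! : ℝ) ^ s) * Real.exp r') (n : ℕ) :
    ‖iteratedFDeriv ℝ n (fun y => g y * f y) x‖ ≤
      C * C' * ((2 * h) ^ n * (n ! : ℝ) ^ s) * Real.exp (r' - r * ‖x‖ ^ t⁻¹) := by
  have hC' : 0 ≤ C' := by
    have := (norm_nonneg _).trans (Hg 0)
    simp only [pow_zero, Nat.factorial_zero, Nat.cast_one, Real.one_rpow, mul_one] at this
    exact nonneg_of_mul_nonneg_left this (Real.exp_pos _)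
  refine (norm_iteratedFDeriv_mul_le hg hf x (n := n) (WithTop.coe_le_coe.2 le_top)).trans ?_
  have hterm : ∀ i ∈ Finset.range (n + 1),
      (n.choose i : ℝ) * ‖iteratedFDeriv ℝ i g x‖ * ‖iteratedFDeriv ℝ (n - i) f x‖ ≤
      (n.choose i : ℝ) * (C * C' * (h ^ n * (n ! : ℝ) ^ s) *
        Real.exp (r' - r * ‖x‖ ^ t⁻¹)) := by
    intro i hi
    have hin : i ≤ n := Nat.lt_succ_iff.1 (Finset.mem_range.1 hi)
    rw [mul_assoc]
    refine mul_le_mul_of_nonneg_left ?_ (by positivity)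
    refine (mul_le_mul (Hg i) (Hf (n - i) x) (norm_nonneg _) (by positivity)).trans ?_
    have e := factorial_rpow_mul_le hs hin
    calc C' * (h ^ i * (i ! : ℝ) ^ s) * Real.exp r' *
          (C * (h ^ (n - i) * ((n - i)! : ℝ) ^ s) * Real.exp (-(r * ‖x‖ ^ t⁻¹)))
        = C * C' * (h ^ i * h ^ (n - i) * ((i ! : ℝ) ^ s * ((n - i)! : ℝ) ^ s)) *
          (Real.exp r' * Real.exp (-(r * ‖x‖ ^ t⁻¹))) := by ring
      _ ≤ _ := by
        rw [← pow_add, Nat.add_sub_cancel' hin, ← Real.exp_add, ← sub_eq_add_neg]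
        gcongr
  refine (Finset.sum_le_sum hterm).trans_eq ?_
  rw [← Finset.sum_mul]
  have hsum : ∑ i ∈ Finset.range (n + 1), (n.choose i : ℝ) = 2 ^ n := by
    exact_mod_cast Nat.sum_range_choose n
  rw [hsum, mul_pow]
  ring

lemma ExpBound.modulate {t s h r C : ℝ} (hs : 0 < s) (hh : 0 < h) (hC : 0 ≤ C)
    {f : RSpace d → ℂ} (hf : ContDiff ℝ ∞ f) (H : ExpBound t s h r C f) (ξ : RSpace d) :
    ExpBound t s (2 * h) r (C * Real.exp (s / h ^ s⁻¹ * ‖ξ‖ ^ s⁻¹))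
      (fun y => character ξ y * f y) := by
  intro n x
  refine (H.mul (C' := 1) (r' := s / h ^ s⁻¹ * ‖ξ‖ ^ s⁻¹) hs hh.le hC hf
    (contDiff_character ξ) (fun n => ?_) n).trans_eq ?_
  · refine (norm_iteratedFDeriv_character_le ξ n x).trans
      ((pow_le_exp_div_rpow_mul hs hh (norm_nonneg ξ) n).trans_eq ?_)
    ring
  · rw [sub_eq_add_neg, Real.exp_add]
    ring

/-- Mean value inequality for the n-th derivative on the segment from x to x - a. The additional
derivative costs (n + 1)^s, absorbed by doubling h; the gain is the factor ‖a‖, which tends to zero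
with a. -/
lemma ExpBound.translate_sub {t s h r C : ℝ} (ht : 0 < t) (hh : 0 ≤ h) (hr : 0 ≤ r)
    (hC : 0 ≤ C) {K : ℝ} (hK : ∀ n : ℕ, ((n : ℝ) + 1) ^ s ≤ K * 2 ^ n)
    {f : RSpace d → ℂ} (hf : ContDiff ℝ ∞ f) (H : ExpBound t s h (r * 2 ^ t⁻¹) C f)
    (a : RSpace d) :
    ExpBound t s (2 * h) r (‖a‖ * (C * h * K * Real.exp (r * 2 ^ t⁻¹ * ‖a‖ ^ t⁻¹)))
      (fun y => f (y - a) - f y) := by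
  intro n x
  have hfa : ContDiff ℝ ∞ (fun y => f (y - a)) := hf.comp (contDiff_id.sub contDiff_const)
  have hsub : iteratedFDeriv ℝ n (fun y => f (y - a) - f y) x =
      iteratedFDeriv ℝ n f (x - a) - iteratedFDeriv ℝ n f x := by
    have := iteratedFDeriv_sub_apply (𝕜 := ℝ) (i := n) (x := x)
      ((hfa.of_le (WithTop.coe_le_coe.2 le_top)).contDiffAt)
      ((hf.of_le (WithTop.coe_le_coe.2 le_top)).contDiffAt)
    rw [← iteratedFDeriv_comp_sub n a x]
    exact this
  rw [hsub]
  set B : ℝ := C * h * K * Real.exp (r * 2 ^ t⁻¹ * ‖a‖ ^ t⁻¹) * ((2 * h) ^ n * (n ! : ℝ) ^ s) *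
    Real.exp (-(r * ‖x‖ ^ t⁻¹)) with hB
  have hseg : ∀ z ∈ segment ℝ x (x - a), ‖fderiv ℝ (iteratedFDeriv ℝ n f) z‖ ≤ B := by
    intro z hz
    obtain ⟨θ, ⟨hθ0, hθ1⟩, rfl⟩ := (segment_eq_image' ℝ x (x - a)) ▸ hz
    have hz' : x + θ • (x - a - x) = x - θ • a := by
      rw [sub_sub_cancel_left, smul_neg, sub_eq_add_neg]
    simp only [hz']
    rw [norm_fderiv_iteratedFDeriv]
    refine (H (n + 1) _).trans ?_
    have h1 := exp_neg_rpow_sub_le ht hr x (θ • a)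
    have h2 : ‖θ • a‖ ≤ ‖a‖ := by
      rw [norm_smul, Real.norm_of_nonneg hθ0]
      exact mul_le_of_le_one_left (norm_nonneg _) hθ1
    have h3 : Real.exp (r * 2 ^ t⁻¹ * ‖θ • a‖ ^ t⁻¹) ≤ Real.exp (r * 2 ^ t⁻¹ * ‖a‖ ^ t⁻¹) := by
      have := (inv_pos.2 ht).le
      gcongr
    have h4 : ((n + 1)! : ℝ) ^ s ≤ K * 2 ^ n * (n ! : ℝ) ^ s := by
      rw [Nat.factorial_succ]
      push_cast
      rw [Real.mul_rpow (by positivity) (by positivity)]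
      exact mul_le_mul_of_nonneg_right (hK n) (by positivity)
    calc C * (h ^ (n + 1) * ((n + 1)! : ℝ) ^ s) * Real.exp (-(r * 2 ^ t⁻¹ * ‖x - θ • a‖ ^ t⁻¹))
        ≤ C * (h ^ (n + 1) * (K * 2 ^ n * (n ! : ℝ) ^ s)) *
          (Real.exp (r * 2 ^ t⁻¹ * ‖a‖ ^ t⁻¹) * Real.exp (-(r * ‖x‖ ^ t⁻¹))) := by
          have := (Real.rpow_nonneg (by positivity : (0:ℝ) ≤ ((n + 1)! : ℝ)) s).trans h4
          gcongr
          exact h1.trans (mul_le_mul_of_nonneg_right h3 (Real.exp_pos _).le)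
      _ = B := by rw [hB, mul_pow]; ring
  have hd : ∀ z ∈ segment ℝ x (x - a), DifferentiableAt ℝ (iteratedFDeriv ℝ n f) z := fun z _ =>
    (hf.differentiable_iteratedFDeriv (m := n) (WithTop.coe_lt_coe.2 (ENat.natCast_lt_top _))) z
  have := (convex_segment x (x - a)).norm_image_sub_le_of_norm_fderiv_le (𝕜 := ℝ) hd hseg
    (left_mem_segment ℝ _ _) (right_mem_segment ℝ _ _)
  refine this.trans_eq ?_
  rw [sub_sub_cancel_left, norm_neg, hB]
  ring

lemma norm_character_sub_one_le (ξ x : RSpace d) : ‖character ξ x - 1‖ ≤ ‖ξ‖ * ‖x‖ := by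
  have h1 : ‖character ξ x - 1‖ ≤ ‖(inner ℝ x ξ : ℝ)‖ := by
    have := Real.norm_exp_I_mul_ofReal_sub_one_le (x := (inner ℝ x ξ : ℝ))
    simpa [character] using this
  refine h1.trans ((norm_inner_le_norm x ξ).trans_eq (mul_comm _ _))

lemma norm_iteratedFDeriv_character_sub_one_le (ξ x : RSpace d) (hξ : ‖ξ‖ ≤ 1) (n : ℕ) :
    ‖iteratedFDeriv ℝ n (fun y => character ξ y - 1) x‖ ≤ ‖ξ‖ * (1 + ‖x‖) := by
  rcases n with _ | n
  · rw [norm_iteratedFDeriv_zero]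
    refine (norm_character_sub_one_le ξ x).trans ?_
    gcongr
    linarith
  · have h1 : iteratedFDeriv ℝ (n + 1) (fun y => character ξ y - 1) x =
        iteratedFDeriv ℝ (n + 1) (character ξ) x := by
      have := iteratedFDeriv_sub_apply (𝕜 := ℝ) (i := n + 1) (x := x) (f := character ξ)
        (g := fun _ => (1 : ℂ))
        (((contDiff_character ξ).of_le (WithTop.coe_le_coe.2 le_top)).contDiffAt)
        contDiff_const.contDiffAt
      rw [iteratedFDeriv_const_of_ne (Nat.succ_ne_zero n)] at this
      rw [Pi.zero_apply, sub_zero] at this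
      exact this
    rw [h1]
    refine (norm_iteratedFDeriv_character_le ξ (n + 1) x).trans ?_
    rw [pow_succ']
    exact mul_le_mul_of_nonneg_left ((pow_le_one₀ (norm_nonneg _) hξ).trans
      (le_add_of_nonneg_right (norm_nonneg _))) (norm_nonneg _)

/-- The growth 1 + ‖x‖ of the derivatives of the character minus one is absorbed by one unit of the
decay rate, hence r + 1. The factor ‖ξ‖ yields continuity in the frequency. -/
lemma ExpBound.exists_modulate_sub {t s h r : ℝ} (ht : 0 < t) (hs : 0 < s) (hh : 0 < h) :
    ∃ K : ℝ, 0 < K ∧ ∀ (C : ℝ) (f : RSpace d → ℂ) (ξ : RSpace d), 0 ≤ C → ContDiff ℝ ∞ f →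
      ExpBound t s h (r + 1) C f → ‖ξ‖ ≤ 1 →
      ExpBound t s (2 * h) r (‖ξ‖ * (C * K)) (fun y => (character ξ y - 1) * f y) := by
  obtain ⟨B, hB0, hB⟩ := exists_pow_le hs hh (zero_le_one (α := ℝ))
  obtain ⟨L, hL0, hL⟩ := exists_one_add_pow_le_exp ht 1
  refine ⟨B * L, by positivity, fun C f ξ hC hf H hξ n x => ?_⟩
  refine (H.mul (C' := ‖ξ‖ * (B * L)) (r' := ‖x‖ ^ t⁻¹) hs hh.le hC hf
    ((contDiff_character ξ).sub contDiff_const) (fun n => ?_) n).trans_eq ?_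
  · refine (norm_iteratedFDeriv_character_sub_one_le ξ x hξ n).trans ?_
    have h1 := hL ‖x‖ (norm_nonneg _)
    rw [pow_one] at h1
    have h2 := hB n
    rw [one_pow] at h2
    calc ‖ξ‖ * (1 + ‖x‖) ≤ ‖ξ‖ * (L * Real.exp (‖x‖ ^ t⁻¹)) * 1 := by
          rw [mul_one]; gcongr
      _ ≤ ‖ξ‖ * (L * Real.exp (‖x‖ ^ t⁻¹)) * (B * (h ^ n * (n ! : ℝ) ^ s)) := by gcongr
      _ = _ := by ring
  · rw [show ‖x‖ ^ t⁻¹ - (r + 1) * ‖x‖ ^ t⁻¹ = -(r * ‖x‖ ^ t⁻¹) by ring]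
    ring

end Estimates

/-! ### The homogeneous phase space weight; growth and continuity of time-frequency shifts -/

section Shifts

open scoped ContDiff Nat Topology

/-- The weight `|x|^{1/t} + |ξ|^{1/s}`, homogeneous of degree one for the dilations
`(x, ξ) ↦ (λ^t x, λ^s ξ)`. -/
def phaseWeight (t s : ℝ) (z : PhaseSpace d) : ℝ := ‖z.1‖ ^ t⁻¹ + ‖z.2‖ ^ s⁻¹

lemma continuous_norm_rpow_inv {E : Type*} [SeminormedAddCommGroup E] {t : ℝ} (ht : 0 < t) :
    Continuous fun x : E => ‖x‖ ^ t⁻¹ :=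
  continuous_norm.rpow_const fun _ => Or.inr (inv_pos.2 ht).le

lemma exists_phaseWeight_add_le {t s : ℝ} (ht : 0 < t) (hs : 0 < s) :
    ∃ K : ℝ, 0 < K ∧ ∀ z w : PhaseSpace d,
      phaseWeight t s (z + w) ≤ K * (phaseWeight t s z + phaseWeight t s w) := by
  refine ⟨2 ^ t⁻¹ + 2 ^ s⁻¹, by positivity, fun z w => ?_⟩
  have key : ∀ (q : ℝ), 0 < q → ∀ x y : RSpace d,
      ‖x + y‖ ^ q⁻¹ ≤ 2 ^ q⁻¹ * (‖x‖ ^ q⁻¹ + ‖y‖ ^ q⁻¹) := fun q hq x y =>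
    (Real.rpow_le_rpow (norm_nonneg _) (norm_add_le x y) (inv_pos.2 hq).le).trans
      (add_rpow_inv_le hq (norm_nonneg _) (norm_nonneg _))
  have h1 := key t ht z.1 w.1
  have h2 := key s hs z.2 w.2
  unfold phaseWeight
  have e1 : 0 ≤ (2 : ℝ) ^ t⁻¹ * (‖z.2‖ ^ s⁻¹ + ‖w.2‖ ^ s⁻¹) := by positivity
  have e2 : 0 ≤ (2 : ℝ) ^ s⁻¹ * (‖z.1‖ ^ t⁻¹ + ‖w.1‖ ^ t⁻¹) := by positivity
  simp only [Prod.fst_add, Prod.snd_add]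
  linarith

lemma phaseWeight_dilation {t s : ℝ} (ht : 0 < t) (hs : 0 < s) {l : ℝ} (hl : 0 ≤ l)
    (z : PhaseSpace d) : phaseWeight t s (l ^ t • z.1, l ^ s • z.2) = l * phaseWeight t s z := by
  have key : ∀ (q : ℝ), 0 < q → ∀ x : RSpace d, ‖l ^ q • x‖ ^ q⁻¹ = l * ‖x‖ ^ q⁻¹ := by
    intro q hq x
    rw [norm_smul, Real.norm_of_nonneg (by positivity), Real.mul_rpow (by positivity)
      (norm_nonneg _), Real.rpow_rpow_inv hl hq.ne']
  unfold phaseWeight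
  rw [key t ht, key s hs, mul_add]

/-- `Σ_t^s(ℝ^d)` carries the topology of the seminorms `gsSeminorm`. -/
lemma withSeminorms_gsSeminorm (d : ℕ) (t s : ℝ) :
    WithSeminorms (show SeminormFamily ℂ (GSSpace d t s) (Set.Ioi (0 : ℝ)) from
      gsSeminorm d t s) := ⟨rfl⟩

lemma ExpBound.add {t s h r C C' : ℝ} {f g : RSpace d → ℂ} (hf : ContDiff ℝ ∞ f)
    (hg : ContDiff ℝ ∞ g) (Hf : ExpBound t s h r C f) (Hg : ExpBound t s h r C' g) :
    ExpBound t s h r (C + C') (fun y => f y + g y) := by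
  intro n x
  have h1 := iteratedFDeriv_add_apply (𝕜 := ℝ) (i := n) (x := x)
      ((hf.of_le (WithTop.coe_le_coe.2 le_top)).contDiffAt)
      ((hg.of_le (WithTop.coe_le_coe.2 le_top)).contDiffAt)
  change iteratedFDeriv ℝ n (fun y => f y + g y) x = _ at h1
  rw [h1, add_mul, add_mul]
  exact (norm_add_le _ _).trans (add_le_add (Hf n x) (Hg n x))

lemma exists_gsSeminorm_timeFreqShift_le {t s : ℝ} (ht : 0 < t) (hs : 0 < s)
    (h : Set.Ioi (0 : ℝ)) (ψ : GSSpace d t s) : ∃ C r : ℝ, 0 ≤ C ∧ 0 < r ∧ ∀ z : PhaseSpace d,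
      gsSeminorm d t s h (timeFreqShift ht hs z.1 z.2 ψ) ≤
        C * Real.exp (r * phaseWeight t s z) := by
  obtain ⟨g, r, hg, hr, H⟩ := exists_gsSeminorm_le_of_expBound (d := d) ht hs h
  -- Modulation will double g / 2 and translation will divide the rate by 2^{1/t}.
  obtain ⟨C, hC0, hC⟩ := ψ.exists_expBound ht hs (h := g / 2) (r := r * 2 ^ t⁻¹)
    (by positivity) (by positivity)
  refine ⟨C, r * 2 ^ t⁻¹ + s / (g / 2) ^ s⁻¹, hC0, by positivity, fun z => ?_⟩
  have h1 := (hC.translate ht (by positivity) hr.le hC0 z.1).modulate hs (by positivity)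
    (by positivity) (ψ.contDiff.comp (contDiff_id.sub contDiff_const)) z.2
  rw [mul_div_cancel₀ g (two_ne_zero)] at h1
  refine (H _ (timeFreqShift ht hs z.1 z.2 ψ) (by positivity) h1).trans ?_
  rw [mul_assoc, ← Real.exp_add]
  refine mul_le_mul_of_nonneg_left (Real.exp_le_exp.2 ?_) hC0
  unfold phaseWeight
  have e1 : 0 ≤ r * 2 ^ t⁻¹ * ‖z.2‖ ^ s⁻¹ := by positivity
  have e2 : 0 ≤ s / (g / 2) ^ s⁻¹ * ‖z.1‖ ^ t⁻¹ := by positivity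
  linarith

lemma character_add (ξ η y : RSpace d) : character (ξ + η) y = character ξ y * character η y := by
  unfold character
  rw [← Complex.exp_add, inner_add_right]
  push_cast
  ring_nf

/-- Time-frequency shifts of a fixed function depend continuously on the shift, in the topology
of `Σ_t^s(ℝ^d)`. -/
lemma continuous_timeFreqShift {t s : ℝ} (ht : 0 < t) (hs : 0 < s) (ψ : GSSpace d t s) :
    Continuous fun z : PhaseSpace d => timeFreqShift ht hs z.1 z.2 ψ := by
  rw [continuous_iff_continuousAt]
  intro w
  refine ((withSeminorms_gsSeminorm d t s).tendsto_nhds _ _).2 fun h ε hε => ?_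
  obtain ⟨g, r, hg, hr, H⟩ := exists_gsSeminorm_le_of_expBound (d := d) ht hs h
  obtain ⟨K, hK0, hK⟩ := exists_succ_rpow_le hs
  have hg2 : 0 < g / 2 := by positivity
  have hg4 : 0 < g / 2 / 2 := by positivity
  have e2 : 2 * (g / 2) = g := by ring
  have e4 : 2 * (g / 2 / 2) = g / 2 := by ring
  obtain ⟨L, hL0, hL⟩ := ExpBound.exists_modulate_sub (d := d) (r := r) ht hs hg4
  -- In both estimates h is doubled twice, hence g / 4. The first involves two translations; the
  -- second involves one translation and the loss of one unit of rate.
  obtain ⟨C, hC0, hC⟩ := ψ.exists_expBound ht hs (h := g / 2 / 2) (r := r * 2 ^ t⁻¹ * 2 ^ t⁻¹)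
    hg4 (by positivity)
  obtain ⟨C', hC'0, hC'⟩ := ψ.exists_expBound ht hs (h := g / 2 / 2) (r := (r + 1) * 2 ^ t⁻¹)
    hg4 (by positivity)
  -- With z = (x, ξ) and w = (a, α), the difference of the shifted windows is M_ξ T_a (T_{x-a} ψ -
  -- ψ) + M_α ((M_{ξ-α} - 1) T_a ψ). `A` and `B` bound the two terms, and both vanish at z = w.
  set A : PhaseSpace d → ℝ := fun z =>
    ‖z.1 - w.1‖ * (C * (g / 2 / 2) * K *
      Real.exp (r * 2 ^ t⁻¹ * 2 ^ t⁻¹ * ‖z.1 - w.1‖ ^ t⁻¹)) *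
      Real.exp (r * 2 ^ t⁻¹ * ‖w.1‖ ^ t⁻¹) * Real.exp (s / (g / 2) ^ s⁻¹ * ‖z.2‖ ^ s⁻¹) with hA
  set B : PhaseSpace d → ℝ := fun z =>
    ‖z.2 - w.2‖ * (C' * Real.exp ((r + 1) * 2 ^ t⁻¹ * ‖w.1‖ ^ t⁻¹) * L) *
      Real.exp (s / (g / 2) ^ s⁻¹ * ‖w.2‖ ^ s⁻¹) with hB
  have hcont : Continuous fun z => A z + B z := by
    have c1 : Continuous fun z : PhaseSpace d => ‖z.1 - w.1‖ ^ t⁻¹ :=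
      (continuous_norm_rpow_inv ht).comp (continuous_fst.sub continuous_const)
    have c2 : Continuous fun z : PhaseSpace d => ‖z.2‖ ^ s⁻¹ :=
      (continuous_norm_rpow_inv hs).comp continuous_snd
    fun_prop
  have hlim : Filter.Tendsto (fun z => A z + B z) (𝓝 w) (𝓝 0) := by
    have h0 := hcont.tendsto w
    simpa [hA, hB] using h0
  have hball : ∀ᶠ z in 𝓝 w, ‖z.2 - w.2‖ ≤ 1 := by
    have : Continuous fun z : PhaseSpace d => ‖z.2 - w.2‖ := by fun_prop
    have h1 := this.tendsto w
    simp only [sub_self, norm_zero] at h1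
    exact (h1.eventually (gt_mem_nhds one_pos)).mono fun _ hz => hz.le
  filter_upwards [hlim.eventually (gt_mem_nhds hε), hball] with z hz hz1
  refine lt_of_le_of_lt ?_ hz
  have cd : ContDiff ℝ ∞ fun y => ψ.toFun (y - (z.1 - w.1)) - ψ.toFun y :=
    (ψ.contDiff.comp (contDiff_id.sub contDiff_const)).sub ψ.contDiff
  have cd' : ContDiff ℝ ∞ fun y => ψ.toFun (y - w.1 - (z.1 - w.1)) - ψ.toFun (y - w.1) :=
    cd.comp (contDiff_id.sub contDiff_const)
  have cw : ContDiff ℝ ∞ fun y => ψ.toFun (y - w.1) :=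
    ψ.contDiff.comp (contDiff_id.sub contDiff_const)
  have cm : ContDiff ℝ ∞ fun y => (character (z.2 - w.2) y - 1) * ψ.toFun (y - w.1) :=
    ((contDiff_character _).sub contDiff_const).mul cw
  have b1 := hC.translate_sub ht hg4.le (by positivity) hC0 hK ψ.contDiff (z.1 - w.1)
  rw [e4] at b1
  have b2 := (b1.translate ht hg2.le hr.le (by positivity) w.1).modulate hs hg2 (by positivity)
    cd' z.2
  have b3 := hL _ _ (z.2 - w.2) (by positivity) cw
    (hC'.translate ht hg4.le (by positivity) hC'0 w.1) hz1
  rw [e4] at b3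
  have b4 := b3.modulate hs hg2 (by positivity) cm w.2
  rw [e2] at b2 b4
  have b5 := ExpBound.add ((contDiff_character _).mul cd') ((contDiff_character _).mul cm) b2 b4
  refine H _ _ (by positivity) ?_
  convert b5 using 1
  funext y
  change character z.2 y * ψ.toFun (y - z.1) - character w.2 y * ψ.toFun (y - w.1) = _
  have h1 : character z.2 y = character w.2 y * character (z.2 - w.2) y := by
    rw [← character_add, add_sub_cancel]
  rw [show y - w.1 - (z.1 - w.1) = y - z.1 by abel, h1]
  ring

end Shifts

section Functionals

open scoped ContDiff Nat Topology ENNReal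
open MeasureTheory

/-! ### Functionals and integrals -/

lemma gsSeminorm_antitone (d : ℕ) (t s : ℝ) {h h' : Set.Ioi (0 : ℝ)} (hle : h ≤ h') :
    gsSeminorm d t s h' ≤ gsSeminorm d t s h := by
  intro f
  refine ciSup_le fun p => le_trans ?_ (le_ciSup (f.bddAbove h.2) p)
  have h0 : 0 < h.1 := h.2
  have h1 : h.1 ≤ h'.1 := hle
  have := multiFactorial_pos p.1
  have := multiFactorial_pos p.2.1
  refine div_le_div_of_nonneg_left (norm_nonneg _) (gsDenom_pos h0 p) ?_
  gcongr

/-- Continuity gives a bound by finitely many seminorms; these increase as h decreases, so the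
smallest h occurring suffices. -/
lemma GSDual.exists_bound {t s : ℝ} (u : GSDual d t s) :
    ∃ (h : Set.Ioi (0 : ℝ)) (C : ℝ), 0 ≤ C ∧ ∀ f, ‖u f‖ ≤ C * gsSeminorm d t s h f := by
  obtain ⟨S, C, -, hC⟩ := Seminorm.bound_of_continuous (withSeminorms_gsSeminorm d t s)
    ((normSeminorm ℂ ℂ).comp u.toLinearMap) (u.continuous.norm)
  obtain ⟨h, hh⟩ : ∃ h : Set.Ioi (0 : ℝ), ∀ i ∈ S, h ≤ i := by
    rcases S.eq_empty_or_nonempty with rfl | hne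
    · exact ⟨⟨1, Set.mem_Ioi.2 one_pos⟩, by simp⟩
    · exact ⟨S.min' hne, fun i hi => S.min'_le i hi⟩
  refine ⟨h, C, C.2, fun f => (hC f).trans ?_⟩
  exact mul_le_mul_of_nonneg_left
    ((Finset.sup_le fun i hi => gsSeminorm_antitone d t s (hh i hi) :
      S.sup (gsSeminorm d t s) ≤ gsSeminorm d t s h) f) C.2

/-- The normalized quantity `x^α ∂^β f(x) / (h^{|α+β|} α!^t β!^s)`. -/
def gsCoordinate (t s h : ℝ) (f : RSpace d → ℂ)
    (p : (Fin d → ℕ) × (Fin d → ℕ) × RSpace d) : ℂ :=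
  (((h ^ (∑ i, (p.1 i + p.2.1 i)) * multiFactorial p.1 ^ t * multiFactorial p.2.1 ^ s : ℝ) : ℂ))⁻¹
    * (monom p.1 p.2.2 : ℂ) * multiDeriv p.2.1 f p.2.2

lemma norm_gsCoordinate {t s h : ℝ} (hh : 0 < h) (f : RSpace d → ℂ)
    (p : (Fin d → ℕ) × (Fin d → ℕ) × RSpace d) :
    ‖gsCoordinate t s h f p‖ = gsQuotient t s h f p := by
  unfold gsCoordinate gsQuotient
  rw [mul_assoc, norm_mul, norm_inv, Complex.norm_real,
    Real.norm_of_nonneg (gsDenom_pos hh p).le, div_eq_inv_mul]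

/-- The embedding of `Σ_t^s(ℝ^d)` into a space of bounded families that turns
`gsSeminorm d t s h` into the supremum norm. -/
def gsEmbedding (d : ℕ) (t s : ℝ) (h : Set.Ioi (0 : ℝ)) :
    GSSpace d t s →ₗ[ℂ] lp (fun _ : (Fin d → ℕ) × (Fin d → ℕ) × RSpace d => ℂ) ∞ where
  toFun f := ⟨gsCoordinate t s h.1 f.toFun, memℓp_infty_iff.2 (by
    simpa only [norm_gsCoordinate h.2] using f.bddAbove h.2)⟩
  map_add' f g := by
    ext p
    change gsCoordinate t s h.1 (f.toFun + g.toFun) p =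
      gsCoordinate t s h.1 f.toFun p + gsCoordinate t s h.1 g.toFun p
    unfold gsCoordinate
    rw [multiDeriv_add _ f.contDiff g.contDiff, Pi.add_apply, mul_add]
  map_smul' c f := by
    ext p
    change gsCoordinate t s h.1 (c • f.toFun) p = c * gsCoordinate t s h.1 f.toFun p
    unfold gsCoordinate
    rw [multiDeriv_smul _ c f.contDiff, Pi.smul_apply, smul_eq_mul]
    ring

lemma norm_gsEmbedding {t s : ℝ} (h : Set.Ioi (0 : ℝ)) (f : GSSpace d t s) :
    ‖gsEmbedding d t s h f‖ = gsSeminorm d t s h f := by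
  rw [lp.norm_eq_ciSup]
  exact iSup_congr fun p => norm_gsCoordinate h.2 f.toFun p

lemma gsEmbedding_injective {t s : ℝ} (h : Set.Ioi (0 : ℝ)) :
    Function.Injective (gsEmbedding d t s h) := by
  rw [injective_iff_map_eq_zero]
  intro f hf
  refine Subtype.ext (funext fun x => ?_)
  have h1 : gsCoordinate t s h.1 f.toFun (0, 0, x) = 0 :=
    congrFun (congrArg Subtype.val hf) (0, 0, x)
  have h2 : ∀ L : List (Fin d), L.foldr (fun (_ : Fin d) (g : RSpace d → ℂ) => g) f.toFun =
      f.toFun := fun L => by induction L with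
    | nil => rfl
    | cons a L ih => exact ih
  change f.toFun x = 0
  simpa [gsCoordinate, monom, multiFactorial, multiDeriv, h2] using h1

/-- The embedding is isometric for the one seminorm that controls u, so u defines a bounded
functional on its range, and Hahn–Banach applies. The conjugate makes this functional linear. The
target is a Banach space, where Bochner integration is available. -/
lemma GSDual.exists_extension {t s : ℝ} (u : GSDual d t s) : ∃ (h : Set.Ioi (0 : ℝ))
    (L : StrongDual ℂ (lp (fun _ : (Fin d → ℕ) × (Fin d → ℕ) × RSpace d => ℂ) ∞)),
      ∀ f, L (gsEmbedding d t s h f) = star (u f) := by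
  obtain ⟨h, C, hC0, hC⟩ := u.exists_bound
  let e := LinearEquiv.ofInjective (gsEmbedding d t s h) (gsEmbedding_injective h)
  let v : LinearMap.range (gsEmbedding d t s h) →ₗ[ℂ] ℂ :=
    { toFun := fun x => star (u (e.symm x))
      map_add' := fun x y => by simp
      map_smul' := fun c x => by simp }
  let v' := v.mkContinuous C fun x => by
    obtain ⟨f, rfl⟩ := e.surjective x
    change ‖star (u (e.symm (e f)))‖ ≤ C * ‖gsEmbedding d t s h f‖
    rw [e.symm_apply_apply, norm_star, norm_gsEmbedding]
    exact hC f
  obtain ⟨L, hL, -⟩ := exists_extension_norm_eq _ v'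
  refine ⟨h, L, fun f => ?_⟩
  have h1 := hL (e f)
  change L (gsEmbedding d t s h f) = star (u (e.symm (e f))) at h1
  rwa [e.symm_apply_apply] at h1

lemma listDeriv_eq_multiDeriv_count (l : List (Fin d)) {f : RSpace d → ℂ}
    (hf : ContDiff ℝ ∞ f) : listDeriv l f = multiDeriv (fun i => l.count i) f := by
  rw [multiDeriv_eq_listDeriv]
  refine listDeriv_perm (List.Perm.symm ?_) hf
  rw [List.perm_iff_count]
  intro a
  rw [List.count_flatMap]
  simp only [Function.comp_def, List.count_replicate]
  rw [← Fin.sum_univ_def]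
  simp

lemma exists_norm_listDeriv_le (t s : ℝ) (l : List (Fin d)) :
    ∃ C : ℝ, 0 ≤ C ∧ ∀ (f : GSSpace d t s) (x : RSpace d),
      ‖listDeriv l f.toFun x‖ ≤ C * gsSeminorm d t s ⟨1, Set.mem_Ioi.2 one_pos⟩ f := by
  have := multiFactorial_pos (fun i : Fin d => l.count i)
  refine ⟨multiFactorial (fun i : Fin d => l.count i) ^ s, by positivity, fun f x => ?_⟩
  have h1 := le_ciSup (f.bddAbove (h := 1) one_pos) (0, fun i => l.count i, x)
  rw [listDeriv_eq_multiDeriv_count l f.contDiff]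
  have h2 : gsQuotient t s 1 f.toFun (0, fun i => l.count i, x) =
      ‖multiDeriv (fun i => l.count i) f.toFun x‖ /
        multiFactorial (fun i : Fin d => l.count i) ^ s := by
    simp [gsQuotient, monom, multiFactorial]
  rw [h2, div_le_iff₀ (by positivity), mul_comm] at h1
  exact h1

lemma continuous_listDeriv_apply (t s : ℝ) (l : List (Fin d)) (x : RSpace d) :
    Continuous fun f : GSSpace d t s => listDeriv l f.toFun x := by
  obtain ⟨C, hC0, hC⟩ := exists_norm_listDeriv_le t s l
  rw [continuous_iff_continuousAt]
  intro f
  rw [ContinuousAt, tendsto_iff_norm_sub_tendsto_zero]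
  have h1 : Filter.Tendsto (fun g : GSSpace d t s => C * gsSeminorm d t s ⟨1, Set.mem_Ioi.2 one_pos⟩ (g - f))
      (𝓝 f) (𝓝 0) := by
    have := (withSeminorms_gsSeminorm d t s).topologicalAddGroup
    have h2 : Continuous fun g : GSSpace d t s =>
        C * gsSeminorm d t s ⟨1, Set.mem_Ioi.2 one_pos⟩ (g - f) :=
      continuous_const.mul (((withSeminorms_gsSeminorm d t s).continuous_seminorm _).comp
        (continuous_id.sub continuous_const))
    have h3 := h2.tendsto f
    simpa using h3
  refine squeeze_zero (fun _ => norm_nonneg _) (fun g => ?_) h1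
  have h2 : listDeriv l (g - f).toFun x = listDeriv l g.toFun x - listDeriv l f.toFun x := by
    have e : (g - f).toFun = g.toFun + (-1 : ℂ) • f.toFun := by
      funext y
      change g.toFun y - f.toFun y = g.toFun y + (-1 : ℂ) * f.toFun y
      ring
    have hf' : ContDiff ℝ ∞ ((-1 : ℂ) • f.toFun) := contDiff_const.smul f.contDiff
    rw [e, listDeriv_add l g.contDiff hf', listDeriv_smul l _ f.contDiff]
    simp [sub_eq_add_neg]
  rw [← h2]
  exact hC _ x

/-! ### Superpositions ∫ c(w) g(w) dμ(w) in the Gelfand–Shilov space -/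

section Integral

variable {W : Type*} [TopologicalSpace W] [MeasurableSpace W]
  [OpensMeasurableSpace W] {μ : Measure W} {t s : ℝ} {c : W → ℂ} {g : W → GSSpace d t s}
  {F : GSSpace d t s}

lemma integrable_mul_listDeriv (hc : Continuous c) (hg : Continuous g)
    (hint : Integrable (fun w => ‖c w‖ * gsSeminorm d t s ⟨1, Set.mem_Ioi.2 one_pos⟩ (g w)) μ)
    (l : List (Fin d)) (x : RSpace d) :
    Integrable (fun w => c w * listDeriv l (g w).toFun x) μ := by
  obtain ⟨C, hC0, hC⟩ := exists_norm_listDeriv_le t s l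
  refine (hint.const_mul C).mono'
    (hc.mul ((continuous_listDeriv_apply t s l x).comp hg)).aestronglyMeasurable
    (Filter.Eventually.of_forall fun w => ?_)
  rw [norm_mul]
  calc ‖c w‖ * ‖listDeriv l (g w).toFun x‖
      ≤ ‖c w‖ * (C * gsSeminorm d t s ⟨1, Set.mem_Ioi.2 one_pos⟩ (g w)) :=
        mul_le_mul_of_nonneg_left (hC _ x) (norm_nonneg _)
    _ = _ := by ring

/-- Differentiate under the integral along the lines τ ↦ x + τ e_i, one coordinate at a time,
dominated by a multiple of the seminorm with h = 1. As F is known to be smooth, uniqueness of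
derivatives identifies the result. -/
lemma listDeriv_eq_integral (hc : Continuous c) (hg : Continuous g)
    (hint : Integrable (fun w => ‖c w‖ * gsSeminorm d t s ⟨1, Set.mem_Ioi.2 one_pos⟩ (g w)) μ)
    (hF : ∀ x, F.toFun x = ∫ w, c w * (g w).toFun x ∂μ) (l : List (Fin d)) (x : RSpace d) :
    listDeriv l F.toFun x = ∫ w, c w * listDeriv l (g w).toFun x ∂μ := by
  induction l generalizing x with
  | nil => exact hF x
  | cons i l ih =>
    obtain ⟨C, hC0, hC⟩ := exists_norm_listDeriv_le t s (i :: l)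
    set e : RSpace d := EuclideanSpace.single i 1 with he
    have hline : ∀ (f : GSSpace d t s) (τ : ℝ),
        HasDerivAt (fun τ : ℝ => listDeriv l f.toFun (x + τ • e))
          (listDeriv (i :: l) f.toFun (x + τ • e)) τ := by
      intro f τ
      have h1 : HasFDerivAt (listDeriv l f.toFun) (fderiv ℝ (listDeriv l f.toFun) (x + τ • e))
          (x + τ • e) :=
        ((contDiff_listDeriv l f.contDiff).differentiable (by simp) _).hasFDerivAt
      have h2 : HasDerivAt (fun τ : ℝ => x + τ • e) e τ := by
        simpa using ((hasDerivAt_id τ).smul_const e).const_add x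
      exact h1.comp_hasDerivAt τ h2
    have h3 := (hasDerivAt_integral_of_dominated_loc_of_deriv_le (μ := μ) (x₀ := (0 : ℝ))
      (F := fun τ w => c w * listDeriv l (g w).toFun (x + τ • e))
      (F' := fun τ w => c w * listDeriv (i :: l) (g w).toFun (x + τ • e))
      (bound := fun w => C * (‖c w‖ * gsSeminorm d t s ⟨1, Set.mem_Ioi.2 one_pos⟩ (g w)))
      (s := Set.univ) Filter.univ_mem
      (Filter.Eventually.of_forall fun τ =>
        (integrable_mul_listDeriv hc hg hint l _).aestronglyMeasurable)
      (integrable_mul_listDeriv hc hg hint l _)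
      (integrable_mul_listDeriv hc hg hint (i :: l) _).aestronglyMeasurable
      (Filter.Eventually.of_forall fun w τ _ => by
        rw [norm_mul]
        calc ‖c w‖ * ‖listDeriv (i :: l) (g w).toFun (x + τ • e)‖
            ≤ ‖c w‖ * (C * gsSeminorm d t s ⟨1, Set.mem_Ioi.2 one_pos⟩ (g w)) :=
              mul_le_mul_of_nonneg_left (hC _ _) (norm_nonneg _)
          _ = _ := by ring)
      (hint.const_mul C)
      (Filter.Eventually.of_forall fun w τ _ => (hline (g w) τ).const_mul (c w))).2
    have h4 := hline F 0
    simp only [ih] at h4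
    simpa using h4.unique h3

/-- A continuous conjugate linear functional on `Σ_t^s(ℝ^d)` commutes with superpositions
that converge absolutely in every seminorm. -/
theorem GSDual.apply_eq_integral [SecondCountableTopology W] (u : GSDual d t s) (hc : Continuous c) (hg : Continuous g)
    (hint : ∀ h, Integrable (fun w => ‖c w‖ * gsSeminorm d t s h (g w)) μ)
    (hF : ∀ x, F.toFun x = ∫ w, c w * (g w).toFun x ∂μ) :
    u F = ∫ w, star (c w) * u (g w) ∂μ := by
  obtain ⟨h, L, hL⟩ := u.exists_extension
  have hJ : Continuous (gsEmbedding d t s h) := by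
    rw [continuous_iff_continuousAt]
    intro f
    rw [ContinuousAt, tendsto_iff_norm_sub_tendsto_zero]
    simp only [← map_sub, norm_gsEmbedding]
    have := (withSeminorms_gsSeminorm d t s).topologicalAddGroup
    have h2 : Continuous fun g : GSSpace d t s => gsSeminorm d t s h (g - f) :=
      ((withSeminorms_gsSeminorm d t s).continuous_seminorm _).comp
        (continuous_id.sub continuous_const)
    simpa using h2.tendsto f
  have hI : Integrable (fun w => c w • gsEmbedding d t s h (g w)) μ := by
    refine (hint h).mono' (hc.smul (hJ.comp hg)).aestronglyMeasurable
      (Filter.Eventually.of_forall fun w => ?_)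
    rw [norm_smul, norm_gsEmbedding]
  -- The Bochner integral is identified coordinatewise: evaluations are continuous, and each
  -- coordinate is a normalized x^α ∂^β F(x), so the derivatives may be taken under the integral.
  have hJF : ∫ w, c w • gsEmbedding d t s h (g w) ∂μ = gsEmbedding d t s h F := by
    ext p
    have h1 := (lp.evalCLM ℂ (fun _ : (Fin d → ℕ) × (Fin d → ℕ) × RSpace d => ℂ) ∞
      p).integral_comp_comm hI
    refine Eq.trans h1.symm ?_
    change ∫ w, c w * gsCoordinate t s h.1 (g w).toFun p ∂μ = gsCoordinate t s h.1 F.toFun p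
    unfold gsCoordinate
    rw [multiDeriv_eq_listDeriv, listDeriv_eq_integral hc hg (hint _) hF, ← integral_const_mul]
    refine integral_congr_ae (Filter.Eventually.of_forall fun w => ?_)
    simp only [multiDeriv_eq_listDeriv]
    ring
  have h2 := L.integral_comp_comm hI
  rw [hJF, hL] at h2
  have h3 : u F = star (∫ w, L (c w • gsEmbedding d t s h (g w)) ∂μ) := by
    rw [h2, star_star]
  rw [h3]
  have h4 := integral_conj (μ := μ) (f := fun w => L (c w • gsEmbedding d t s h (g w)))
  refine h4.symm.trans (integral_congr_ae (Filter.Eventually.of_forall fun w => ?_))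
  simp [hL]

end Integral

end Functionals

section Windows

open scoped ContDiff Nat Topology FourierTransform
open MeasureTheory

/-! ### Change of window -/

lemma integrable_exp_neg_norm_rpow_inv {t : ℝ} (ht : 0 < t) :
    Integrable fun x : RSpace d => Real.exp (-(‖x‖ ^ t⁻¹)) := by
  obtain ⟨K, hK0, hK⟩ := exists_one_add_pow_le_exp ht (d + 1)
  have h1 : Integrable fun x : RSpace d => (1 + ‖x‖) ^ (-((d : ℝ) + 1)) :=
    integrable_one_add_norm (by simp)
  refine (h1.const_mul K).mono' (Real.continuous_exp.comp
    (continuous_norm_rpow_inv ht).neg).aestronglyMeasurable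
    (Filter.Eventually.of_forall fun x => ?_)
  rw [Real.norm_of_nonneg (Real.exp_pos _).le, Real.rpow_neg (by positivity), Real.exp_neg,
    ← div_eq_mul_inv, le_div_iff₀ (by positivity), inv_mul_le_iff₀ (Real.exp_pos _),
    mul_comm _ K]
  have := hK ‖x‖ (norm_nonneg x)
  rw [← Real.rpow_natCast] at this
  exact_mod_cast this

lemma integrable_exp_neg_phaseWeight {t s : ℝ} (ht : 0 < t) (hs : 0 < s) :
    Integrable fun z : PhaseSpace d => Real.exp (-phaseWeight t s z) := by
  have h1 := (integrable_exp_neg_norm_rpow_inv (d := d) ht).mul_prod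
    (integrable_exp_neg_norm_rpow_inv (d := d) hs)
  rw [Measure.volume_eq_prod]
  refine h1.congr (Filter.Eventually.of_forall fun z => ?_)
  simp only [phaseWeight, neg_add, Real.exp_add]

lemma GSSpace.exists_norm_le {t s : ℝ} (ht : 0 < t) (hs : 0 < s) (f : GSSpace d t s) :
    ∃ C : ℝ, 0 ≤ C ∧ ∀ x, ‖f.toFun x‖ ≤ C * Real.exp (-(‖x‖ ^ t⁻¹)) := by
  obtain ⟨C, hC0, hC⟩ := f.exists_expBound ht hs one_pos one_pos
  exact ⟨C, hC0, fun x => by simpa using hC 0 x⟩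

lemma GSSpace.exists_norm_le_const {t s : ℝ} (ht : 0 < t) (hs : 0 < s) (f : GSSpace d t s) :
    ∃ C : ℝ, 0 ≤ C ∧ ∀ x, ‖f.toFun x‖ ≤ C := by
  obtain ⟨C, hC0, hC⟩ := f.exists_norm_le ht hs
  exact ⟨C, hC0, fun x => (hC x).trans (mul_le_of_le_one_right hC0
    (Real.exp_le_one_iff.2 (neg_nonpos.2 (by positivity))))⟩

lemma GSSpace.integrable {t s : ℝ} (ht : 0 < t) (hs : 0 < s) (f : GSSpace d t s) :
    Integrable f.toFun := by
  obtain ⟨C, hC0, hC⟩ := f.exists_norm_le ht hs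
  exact ((integrable_exp_neg_norm_rpow_inv ht).const_mul C).mono'
    f.contDiff.continuous.aestronglyMeasurable (Filter.Eventually.of_forall hC)

lemma norm_character (ξ y : RSpace d) : ‖character ξ y‖ = 1 := by
  unfold character
  rw [mul_comm, Complex.norm_exp_ofReal_mul_I]

/-- The Fourier transform of `x ↦ conj ψ(x - y) θ(x)` at `η`: up to normalization, the
short-time Fourier transform of `θ` with window `ψ`. -/
def windowCoeff {t s : ℝ} (ψ θ : GSSpace d t s) (z : PhaseSpace d) : ℂ :=
  𝓕 (fun x : RSpace d => star (ψ.toFun (x - z.1)) * θ.toFun x) z.2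

lemma integrable_windowed {t s : ℝ} (ht : 0 < t) (hs : 0 < s)
    (ψ θ : GSSpace d t s) (y : RSpace d) :
    Integrable fun x : RSpace d => star (ψ.toFun (x - y)) * θ.toFun x := by
  obtain ⟨C, hC0, hC⟩ := ψ.exists_norm_le_const ht hs
  refine (θ.integrable ht hs).bdd_mul (c := C) ?_ (Filter.Eventually.of_forall fun x => ?_)
  · exact (continuous_star.comp (ψ.contDiff.continuous.comp
      (continuous_id.sub continuous_const))).aestronglyMeasurable
  · simpa using hC (x - y)

lemma continuous_windowCoeff {t s : ℝ} (ht : 0 < t) (hs : 0 < s)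
    (ψ θ : GSSpace d t s) : Continuous (windowCoeff ψ θ) := by
  obtain ⟨C, hC0, hC⟩ := ψ.exists_norm_le_const ht hs
  have hψ := ψ.contDiff.continuous
  have hθ := θ.contDiff.continuous
  unfold windowCoeff
  simp_rw [Real.fourier_eq']
  refine continuous_of_dominated (bound := fun x => C * ‖θ.toFun x‖) (fun z => ?_) (fun z => ?_)
    ((θ.integrable ht hs).norm.const_mul C) (Filter.Eventually.of_forall fun x => ?_)
  · refine Continuous.aestronglyMeasurable ?_
    fun_prop
  · refine Filter.Eventually.of_forall fun x => ?_
    rw [norm_smul, Complex.norm_exp_ofReal_mul_I, one_mul, norm_mul, norm_star]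
    exact mul_le_mul_of_nonneg_right (hC _) (norm_nonneg _)
  · fun_prop

/-- The decay of ψ(x - y) is traded for e^{-r|y|^{1/t}} at the price e^{r 2^{1/t} |x|^{1/t}}. The
rate r 2^{1/t} + 1 of θ pays for this and leaves an integrable e^{-|x|^{1/t}}. -/
lemma exists_norm_iteratedFDeriv_windowed_le {t s : ℝ} (ht : 0 < t) (hs : 0 < s)
    (ψ θ : GSSpace d t s) {g r : ℝ} (hg : 0 < g) (hr : 0 < r) :
    ∃ C : ℝ, 0 ≤ C ∧ ∀ (n : ℕ) (x y : RSpace d),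
      ‖iteratedFDeriv ℝ n (fun x => star (ψ.toFun (x - y)) * θ.toFun x) x‖ ≤
        C * (g ^ n * (n ! : ℝ) ^ s) * Real.exp (-(r * ‖y‖ ^ t⁻¹)) *
          Real.exp (-(‖x‖ ^ t⁻¹)) := by
  obtain ⟨A, hA0, hA⟩ := θ.exists_expBound ht hs (h := g / 2) (r := r * 2 ^ t⁻¹ + 1)
    (by positivity) (by positivity)
  obtain ⟨B, hB0, hB⟩ := ψ.exists_expBound ht hs (h := g / 2) (r := r * 2 ^ t⁻¹)
    (by positivity) (by positivity)
  refine ⟨A * B, by positivity, fun n x y => ?_⟩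
  have hψ : ContDiff ℝ ∞ fun x => ψ.toFun (x - y) :=
    ψ.contDiff.comp (contDiff_id.sub contDiff_const)
  have hψ' : ContDiff ℝ ∞ fun x => star (ψ.toFun (x - y)) :=
    Complex.conjLIE.toContinuousLinearEquiv.contDiff.comp hψ
  refine (hA.mul (C' := B) (r' := r * 2 ^ t⁻¹ * ‖x‖ ^ t⁻¹ - r * ‖y‖ ^ t⁻¹) hs (by positivity)
    hA0 θ.contDiff hψ' (fun n => ?_) n).trans_eq ?_
  · have h1 : ‖iteratedFDeriv ℝ n (fun x => star (ψ.toFun (x - y))) x‖ =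
        ‖iteratedFDeriv ℝ n ψ.toFun (x - y)‖ := by
      rw [← iteratedFDeriv_comp_sub n y x]
      exact Complex.conjLIE.norm_iteratedFDeriv_comp_left (fun x => ψ.toFun (x - y)) x n
    rw [h1]
    refine (hB n (x - y)).trans (mul_le_mul_of_nonneg_left ?_ (by positivity))
    rw [norm_sub_rev, sub_eq_add_neg (r * _ * _), Real.exp_add]
    exact exp_neg_rpow_sub_le ht hr.le y x
  · rw [mul_div_cancel₀ g two_ne_zero, mul_assoc (A * B * _), ← Real.exp_add]
    ring_nf

/-- Decay in position is inherited from the windowed product. For the frequency, |η|^n times the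
Fourier transform is bounded by L¹ norms of derivatives of order at most n, and these bounds are
resummed over n by `mul_exp_le_of_forall_pow_le`. -/
lemma exists_norm_windowCoeff_le {t s : ℝ} (ht : 0 < t) (hs : 0 < s)
    (ψ θ : GSSpace d t s) {r : ℝ} (hr : 0 < r) :
    ∃ C : ℝ, 0 ≤ C ∧ ∀ z, ‖windowCoeff ψ θ z‖ ≤ C * Real.exp (-(r * phaseWeight t s z)) := by
  set h : ℝ := (s / (2 * r)) ^ s with hh
  have hh0 : 0 < h := by positivity
  -- h is the value that the resummation requires. The quarter offsets two factors 2^n: one from the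
  -- Fourier estimate, one from the n + 1 ≤ 2^n terms of its sum.
  set g : ℝ := h / 4 with hg
  have hg0 : 0 < g := by positivity
  obtain ⟨C, hC0, hC⟩ := exists_norm_iteratedFDeriv_windowed_le ht hs ψ θ hg0 hr
  -- 1 ≤ B g^k k!^s lifts the bounds for derivatives of order j ≤ n to the bound of order n.
  obtain ⟨B, hB0, hB⟩ := exists_pow_le hs hg0 (zero_le_one (α := ℝ))
  set I : ℝ := ∫ x : RSpace d, Real.exp (-(‖x‖ ^ t⁻¹)) with hI
  have hI0 : 0 ≤ I := integral_nonneg fun _ => (Real.exp_pos _).le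
  refine ⟨2 ^ s * (C * B * I), by positivity, fun z => ?_⟩
  set q : RSpace d → ℂ := fun x => star (ψ.toFun (x - z.1)) * θ.toFun x with hq
  set E : ℝ := Real.exp (-(r * ‖z.1‖ ^ t⁻¹)) with hE
  have hE0 : 0 < E := Real.exp_pos _
  have hqs : ContDiff ℝ ∞ q :=
    (Complex.conjLIE.toContinuousLinearEquiv.contDiff.comp
      (ψ.contDiff.comp (contDiff_id.sub contDiff_const))).mul θ.contDiff
  have hint : ∀ n : ℕ, Integrable fun x => ‖iteratedFDeriv ℝ n q x‖ := by
    intro n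
    refine ((integrable_exp_neg_norm_rpow_inv (d := d) ht).const_mul
      (C * (g ^ n * (n ! : ℝ) ^ s) * E)).mono' ?_ (Filter.Eventually.of_forall fun x => ?_)
    · exact (hqs.continuous_iteratedFDeriv
        (WithTop.coe_le_coe.2 le_top)).norm.aestronglyMeasurable
    · rw [norm_norm]
      exact hC n x z.1
  have hintle : ∀ n : ℕ, ∫ x, ‖iteratedFDeriv ℝ n q x‖ ≤
      C * (g ^ n * (n ! : ℝ) ^ s) * E * I := by
    intro n
    rw [hI, ← integral_const_mul]
    exact integral_mono (hint n) ((integrable_exp_neg_norm_rpow_inv ht).const_mul _)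
      fun x => hC n x z.1
  have key : ∀ n : ℕ, ‖windowCoeff ψ θ z‖ * ‖z.2‖ ^ n ≤
      (C * B * I * E) * (h ^ n * (n ! : ℝ) ^ s) := by
    intro n
    have h1 := Real.pow_mul_norm_iteratedFDeriv_fourier_le (f := q) (K := 0) (N := ⊤) hqs
      (fun k n hk _ => by
        have : k = 0 := by simpa using hk
        subst this
        simpa using hint n) (k := 0) (n := n) le_rfl le_top z.2
    simp only [norm_iteratedFDeriv_zero, pow_zero, one_mul, Nat.cast_zero, mul_zero, zero_add,
      Finset.range_one, Finset.singleton_product, Finset.sum_map,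
      Function.Embedding.coeFn_mk] at h1
    rw [mul_comm]
    refine h1.trans ?_
    have h2 : ∀ j ∈ Finset.range (n + 1), ∫ x, ‖iteratedFDeriv ℝ j q x‖ ≤
        C * B * I * E * (g ^ n * (n ! : ℝ) ^ s) := by
      intro j hj
      have hjn : j ≤ n := Nat.lt_succ_iff.1 (Finset.mem_range.1 hj)
      have h3 := hB (n - j)
      rw [one_pow] at h3
      have h4 := factorial_rpow_mul_le hs hjn
      calc ∫ x, ‖iteratedFDeriv ℝ j q x‖ ≤ C * (g ^ j * (j ! : ℝ) ^ s) * E * I := hintle j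
        _ ≤ C * (g ^ j * (j ! : ℝ) ^ s) * E * I * (B * (g ^ (n - j) * ((n - j)! : ℝ) ^ s)) :=
            le_mul_of_one_le_right (by positivity) h3
        _ = C * B * I * E * ((g ^ j * g ^ (n - j)) * ((j ! : ℝ) ^ s * ((n - j)! : ℝ) ^ s)) := by
            ring
        _ ≤ _ := by
            rw [← pow_add, Nat.add_sub_cancel' hjn]
            gcongr
    have h5 : ((n : ℝ) + 1) ≤ 2 ^ n := by exact_mod_cast Nat.lt_two_pow_self (n := n)
    calc (2 : ℝ) ^ n * ∑ j ∈ Finset.range (n + 1), ∫ x, ‖iteratedFDeriv ℝ j q x‖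
        ≤ 2 ^ n * (((n : ℝ) + 1) * (C * B * I * E * (g ^ n * (n ! : ℝ) ^ s))) := by
          gcongr
          refine (Finset.sum_le_sum h2).trans_eq ?_
          simp
      _ ≤ 2 ^ n * (2 ^ n * (C * B * I * E * (g ^ n * (n ! : ℝ) ^ s))) := by gcongr
      _ = C * B * I * E * ((2 * 2 * g) ^ n * (n ! : ℝ) ^ s) := by
          rw [mul_pow, mul_pow]; ring
      _ = _ := by rw [show 2 * 2 * g = h by rw [hg]; ring]
  have h6 := mul_exp_le_of_forall_pow_le hs hr (norm_nonneg _) (by positivity)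
    (norm_nonneg z.2) key
  have h7 : Real.exp (-(r * phaseWeight t s z)) = E * (Real.exp (r * ‖z.2‖ ^ s⁻¹))⁻¹ := by
    rw [hE, ← Real.exp_neg, ← Real.exp_add]
    unfold phaseWeight
    ring_nf
  rw [h7, ← mul_assoc, ← div_eq_mul_inv, le_div_iff₀ (Real.exp_pos _)]
  linarith

/-- For fixed y, Fourier inversion in η recovers conj ψ(v - y) θ(v); multiplying by ψ(v - y) and
integrating in y leaves ‖ψ‖² θ(v). The factor 2π translates between the normalization of `𝓕` and
that of `character`. -/
lemma integral_windowCoeff_mul {t s : ℝ} (ht : 0 < t) (hs : 0 < s)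
    (ψ θ : GSSpace d t s) (v : RSpace d) :
    ∫ z : PhaseSpace d, windowCoeff ψ θ z *
      (character ((2 * Real.pi) • z.2) v * ψ.toFun (v - z.1)) =
      (∫ x, star (ψ.toFun x) * ψ.toFun x) * θ.toFun v := by
  obtain ⟨C, hC0, hC⟩ := exists_norm_windowCoeff_le ht hs ψ θ one_pos
  obtain ⟨B, hB0, hB⟩ := ψ.exists_norm_le_const ht hs
  have hcw := continuous_windowCoeff ht hs ψ θ
  have hψ := ψ.contDiff.continuous
  have hint : Integrable (fun z : PhaseSpace d => windowCoeff ψ θ z *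
      (character ((2 * Real.pi) • z.2) v * ψ.toFun (v - z.1))) := by
    refine ((integrable_exp_neg_phaseWeight ht hs).const_mul (C * B)).mono' ?_
      (Filter.Eventually.of_forall fun z => ?_)
    · refine Continuous.aestronglyMeasurable ?_
      unfold character
      fun_prop
    · rw [norm_mul, norm_mul, norm_character, one_mul]
      have h1 := mul_le_mul (hC z) (hB (v - z.1)) (norm_nonneg _) (by positivity)
      rw [one_mul] at h1
      linarith
  rw [Measure.volume_eq_prod] at hint ⊢
  rw [integral_prod _ hint]
  have hinner : ∀ y : RSpace d, ∫ η : RSpace d, windowCoeff ψ θ (y, η) *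
      (character ((2 * Real.pi) • η) v * ψ.toFun (v - y)) =
      star (ψ.toFun (v - y)) * ψ.toFun (v - y) * θ.toFun v := by
    intro y
    set q : RSpace d → ℂ := fun x => star (ψ.toFun (x - y)) * θ.toFun x with hq
    have hqc : Continuous q := by
      have := θ.contDiff.continuous
      fun_prop
    have hFi : Integrable (𝓕 q) := by
      refine ((integrable_exp_neg_norm_rpow_inv (d := d) hs).const_mul C).mono'
        (hcw.comp (continuous_const.prodMk continuous_id)).aestronglyMeasurable
        (Filter.Eventually.of_forall fun η => ?_)
      refine (hC (y, η)).trans (mul_le_mul_of_nonneg_left (Real.exp_le_exp.2 ?_) hC0)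
      unfold phaseWeight
      have : 0 ≤ ‖y‖ ^ t⁻¹ := by positivity
      linarith
    have h1 := congrFun (hqc.fourierInv_fourier_eq (integrable_windowed ht hs ψ θ y) hFi) v
    rw [Real.fourierInv_eq'] at h1
    calc ∫ η : RSpace d, windowCoeff ψ θ (y, η) *
          (character ((2 * Real.pi) • η) v * ψ.toFun (v - y))
        = ∫ η : RSpace d, (Complex.exp (((2 * Real.pi * inner ℝ η v : ℝ) : ℂ) * Complex.I) •
            𝓕 q η) * ψ.toFun (v - y) := by
          refine integral_congr_ae (Filter.Eventually.of_forall fun η => ?_)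
          have h2 : character ((2 * Real.pi) • η) v =
              Complex.exp (((2 * Real.pi * inner ℝ η v : ℝ) : ℂ) * Complex.I) := by
            unfold character
            rw [inner_smul_right, real_inner_comm, mul_comm]
          simp only [h2, smul_eq_mul, windowCoeff, hq]
          ring
      _ = q v * ψ.toFun (v - y) := by rw [integral_mul_const, h1]
      _ = _ := by simp only [hq]; ring
  simp_rw [hinner]
  rw [integral_mul_const]
  congr 1
  exact integral_sub_left_eq_self (fun x => star (ψ.toFun x) * ψ.toFun x) volume v

lemma integral_star_mul_self_ne_zero {t s : ℝ} (ht : 0 < t) (hs : 0 < s)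
    (ψ : GSSpace d t s) (hψ : ψ ≠ 0) :
    ∫ x, star (ψ.toFun x) * ψ.toFun x ≠ 0 := by
  obtain ⟨x₀, hx₀⟩ : ∃ x, ψ.toFun x ≠ 0 := by
    by_contra! hcon
    exact hψ (Subtype.ext (funext hcon))
  have hc := ψ.contDiff.continuous
  have h1 : ∀ x, star (ψ.toFun x) * ψ.toFun x = ((‖ψ.toFun x‖ ^ 2 : ℝ) : ℂ) := fun x => by
    rw [Complex.ofReal_pow]
    exact Complex.conj_mul' _
  have h2 : Integrable fun x => ‖ψ.toFun x‖ ^ 2 := by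
    have := (integrable_windowed ht hs ψ ψ 0).norm
    refine this.congr (Filter.Eventually.of_forall fun x => ?_)
    simp [sq]
  simp_rw [h1]
  rw [integral_complex_ofReal]
  refine Complex.ofReal_ne_zero.2 (ne_of_gt ?_)
  rw [integral_pos_iff_support_of_nonneg (fun x => by positivity) h2]
  refine IsOpen.measure_pos _ ((hc.norm.pow 2).isOpen_support) ⟨x₀, ?_⟩
  simpa using hx₀

end Windows

/-! ### Domination of one short-time Fourier transform by another -/

section ChangeOfWindow

open scoped ContDiff Topology
open MeasureTheory

/-- The frequency rescaling `(y, η) ↦ (y, 2π η)`. -/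
def freqScale (w : PhaseSpace d) : PhaseSpace d := (w.1, (2 * Real.pi) • w.2)

lemma continuous_freqScale : Continuous (freqScale : PhaseSpace d → PhaseSpace d) := by
  unfold freqScale
  fun_prop

lemma one_le_two_mul_pi : 1 ≤ 2 * Real.pi := by linarith [Real.pi_gt_three]

lemma phaseWeight_le_freqScale {t s : ℝ} (hs : 0 < s) (w : PhaseSpace d) :
    phaseWeight t s w ≤ phaseWeight t s (freqScale w) := by
  unfold phaseWeight freqScale
  have h1 : ‖w.2‖ ≤ ‖(2 * Real.pi) • w.2‖ := by
    rw [norm_smul, Real.norm_of_nonneg (by positivity)]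
    exact le_mul_of_one_le_left (norm_nonneg _) one_le_two_mul_pi
  have := (inv_pos.2 hs).le
  gcongr

lemma phaseWeight_freqScale_le {t s : ℝ} (hs : 0 < s) (w : PhaseSpace d) :
    phaseWeight t s (freqScale w) ≤ (2 * Real.pi) ^ s⁻¹ * phaseWeight t s w := by
  unfold phaseWeight freqScale
  rw [norm_smul, Real.norm_of_nonneg (by positivity), Real.mul_rpow (by positivity)
    (norm_nonneg _), mul_add]
  have h1 : 1 ≤ (2 * Real.pi) ^ s⁻¹ := Real.one_le_rpow one_le_two_mul_pi (inv_pos.2 hs).le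
  gcongr
  exact le_mul_of_one_le_left (by positivity) h1

lemma exists_norm_windowCoeff_le_freqScale {t s : ℝ} (ht : 0 < t) (hs : 0 < s)
    (ψ φ : GSSpace d t s) {r : ℝ} (hr : 0 < r) : ∃ C : ℝ, 0 ≤ C ∧ ∀ w,
      ‖windowCoeff ψ φ w‖ ≤ C * Real.exp (-(r * phaseWeight t s (freqScale w))) := by
  obtain ⟨C, hC0, hC⟩ := exists_norm_windowCoeff_le ht hs ψ φ
    (show 0 < r * (2 * Real.pi) ^ s⁻¹ by positivity)
  refine ⟨C, hC0, fun w => (hC w).trans ?_⟩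
  refine mul_le_mul_of_nonneg_left (Real.exp_le_exp.2 (neg_le_neg ?_)) hC0
  rw [mul_assoc]
  exact mul_le_mul_of_nonneg_left (phaseWeight_freqScale_le hs w) hr.le

lemma continuous_character_uncurry :
    Continuous fun p : RSpace d × RSpace d => character p.1 p.2 := by
  unfold character
  fun_prop

lemma character_add_apply (ξ x y : RSpace d) :
    character ξ (x + y) = character ξ x * character ξ y := by
  unfold character
  rw [← Complex.exp_add, inner_add_left]
  push_cast
  ring_nf

/-- Short-time Fourier transforms of `u` with respect to two windows are dominated by one another,
up to a convolution with a rapidly decreasing kernel. -/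
lemma exists_norm_stft_le_integral {t s : ℝ} (ht : 0 < t) (hs : 0 < s) {ψ : GSSpace d t s}
    (hψ : ψ ≠ 0) (φ : GSSpace d t s) : ∃ c : PhaseSpace d → ℝ, (∀ w, 0 ≤ c w) ∧
      (∀ r : ℝ, 0 < r → ∃ C : ℝ, 0 ≤ C ∧
        ∀ w, c w ≤ C * Real.exp (-(r * phaseWeight t s (freqScale w)))) ∧
      ∀ (u : GSDual d t s) (z : PhaseSpace d),
        ‖stft ht hs φ u z‖ ≤ ∫ w, c w * ‖stft ht hs ψ u (z + freqScale w)‖ := by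
  set m : ℂ := ∫ x, star (ψ.toFun x) * ψ.toFun x with hm
  have hm0 : m ≠ 0 := integral_star_mul_self_ne_zero ht hs ψ hψ
  refine ⟨fun w => ‖m⁻¹ * windowCoeff ψ φ w‖, fun w => norm_nonneg _, fun r hr => ?_,
    fun u z => ?_⟩
  · obtain ⟨C, hC0, hC⟩ := exists_norm_windowCoeff_le_freqScale ht hs ψ φ hr
    refine ⟨‖m⁻¹‖ * C, by positivity, fun w => ?_⟩
    simp only [norm_mul, mul_assoc]
    exact mul_le_mul_of_nonneg_left (hC w) (norm_nonneg _)
  -- The character is the phase from commuting the translation by z.1 past a modulation. It is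
  -- unimodular, so |c| is independent of z.
  set c : PhaseSpace d → ℂ := fun w =>
    m⁻¹ * windowCoeff ψ φ w * character (freqScale w).2 (-z.1) with hc
  set g : PhaseSpace d → GSSpace d t s := fun w =>
    timeFreqShift ht hs (z + freqScale w).1 (z + freqScale w).2 ψ with hg
  have hcn : ∀ w, ‖c w‖ = ‖m⁻¹ * windowCoeff ψ φ w‖ := fun w => by
    simp only [hc, norm_mul, norm_character, mul_one]
  have hcc : Continuous c :=
    (continuous_const.mul (continuous_windowCoeff ht hs ψ φ)).mul
      (continuous_character_uncurry.comp
        ((continuous_snd.comp continuous_freqScale).prodMk continuous_const))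
  have hgc : Continuous g := (continuous_timeFreqShift ht hs ψ).comp
    (continuous_const.add continuous_freqScale)
  have hint : ∀ h, Integrable (fun w => ‖c w‖ * gsSeminorm d t s h (g w)) := by
    intro h
    obtain ⟨B, r, hB0, hr, hB⟩ := exists_gsSeminorm_timeFreqShift_le ht hs h ψ
    obtain ⟨K, hK0, hK⟩ := exists_phaseWeight_add_le (d := d) ht hs
    -- The part r K of the rate cancels the growth of the seminorms of the shifted window; the
    -- remaining 1 gives integrability.
    obtain ⟨C, hC0, hC⟩ := exists_norm_windowCoeff_le_freqScale ht hs ψ φ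
      (show 0 < r * K + 1 by positivity)
    refine ((integrable_exp_neg_phaseWeight ht hs).const_mul
      (‖m⁻¹‖ * C * B * Real.exp (r * K * phaseWeight t s z))).mono'
      (hcc.norm.mul (((withSeminorms_gsSeminorm d t s).continuous_seminorm h).comp
        hgc)).aestronglyMeasurable (Filter.Eventually.of_forall fun w => ?_)
    rw [Real.norm_of_nonneg (by positivity), hcn, norm_mul]
    set N := phaseWeight t s (freqScale w) with hN
    calc ‖m⁻¹‖ * ‖windowCoeff ψ φ w‖ * gsSeminorm d t s h (g w)
        ≤ ‖m⁻¹‖ * (C * Real.exp (-((r * K + 1) * N))) *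
          (B * Real.exp (r * phaseWeight t s (z + freqScale w))) := by
          gcongr
          · exact hC w
          · exact hB _
      _ ≤ ‖m⁻¹‖ * (C * Real.exp (-((r * K + 1) * N))) *
          (B * Real.exp (r * (K * (phaseWeight t s z + N)))) := by
          gcongr
          exact hK _ _
      _ = ‖m⁻¹‖ * C * B * Real.exp (r * K * phaseWeight t s z) * Real.exp (-N) := by
          have e : Real.exp (-((r * K + 1) * N)) * Real.exp (r * (K * (phaseWeight t s z + N))) =
              Real.exp (r * K * phaseWeight t s z) * Real.exp (-N) := by
            rw [← Real.exp_add, ← Real.exp_add]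
            ring_nf
          linear_combination (‖m⁻¹‖ * C * B) * e
      _ ≤ _ := by
          gcongr
          exact phaseWeight_le_freqScale hs w
  have hF : ∀ v, (timeFreqShift ht hs z.1 z.2 φ).toFun v = ∫ w, c w * (g w).toFun v := by
    intro v
    change character z.2 v * φ.toFun (v - z.1) = _
    have h1 := integral_windowCoeff_mul ht hs ψ φ (v - z.1)
    rw [← hm] at h1
    have h2 : φ.toFun (v - z.1) = m⁻¹ * ∫ w : PhaseSpace d, windowCoeff ψ φ w *
        (character ((2 * Real.pi) • w.2) (v - z.1) * ψ.toFun (v - z.1 - w.1)) := by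
      rw [h1, inv_mul_cancel_left₀ hm0]
    rw [h2, ← integral_const_mul, ← integral_const_mul]
    refine integral_congr_ae (Filter.Eventually.of_forall fun w => ?_)
    change character z.2 v * (m⁻¹ * (windowCoeff ψ φ w *
        (character ((2 * Real.pi) • w.2) (v - z.1) * ψ.toFun (v - z.1 - w.1)))) =
      m⁻¹ * windowCoeff ψ φ w * character ((2 * Real.pi) • w.2) (-z.1) *
        (character (z.2 + (2 * Real.pi) • w.2) v * ψ.toFun (v - (z.1 + w.1)))
    rw [sub_eq_add_neg v z.1, character_add_apply, character_add, ← sub_eq_add_neg, sub_sub]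
    ring
  have hu := u.apply_eq_integral hcc hgc hint hF
  unfold stft
  rw [hu, ← integral_const_mul]
  refine (norm_integral_le_integral_norm _).trans_eq
    (integral_congr_ae (Filter.Eventually.of_forall fun w => ?_))
  simp only [norm_mul, norm_star, hcn, hg]
  ring

lemma exists_norm_stft_le {t s : ℝ} (ht : 0 < t) (hs : 0 < s) (ψ : GSSpace d t s)
    (u : GSDual d t s) : ∃ C r : ℝ, 0 ≤ C ∧ 0 < r ∧ ∀ z,
      ‖stft ht hs ψ u z‖ ≤ C * Real.exp (r * phaseWeight t s z) := by
  obtain ⟨h, B, hB0, hB⟩ := u.exists_bound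
  obtain ⟨C, r, hC0, hr, hC⟩ := exists_gsSeminorm_timeFreqShift_le ht hs h ψ
  refine ⟨‖(((2 * Real.pi) ^ (-((d : ℝ) / 2)) : ℝ) : ℂ)‖ * (B * C), r, by positivity, hr,
    fun z => ?_⟩
  unfold stft
  rw [norm_mul, mul_assoc, mul_assoc]
  exact mul_le_mul_of_nonneg_left ((hB _).trans (mul_le_mul_of_nonneg_left (hC z) hB0))
    (norm_nonneg _)

/-! ### Transfer of decay along the anisotropic dilations -/

lemma norm_lt_of_phaseWeight_le {t s ε δ : ℝ} (ht : 0 < t) (hs : 0 < s) (hδ : 0 < δ)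
    (hεt : ε < δ ^ t⁻¹) (hεs : ε < δ ^ s⁻¹) {w : PhaseSpace d} (hw : phaseWeight t s w ≤ ε) :
    ‖w‖ < δ := by
  unfold phaseWeight at hw
  have h1 : 0 ≤ ‖w.1‖ ^ t⁻¹ := by positivity
  have h2 : 0 ≤ ‖w.2‖ ^ s⁻¹ := by positivity
  rw [Prod.norm_def, max_lt_iff]
  exact ⟨(Real.rpow_lt_rpow_iff (norm_nonneg _) hδ.le (inv_pos.2 ht)).1 (by linarith),
    (Real.rpow_lt_rpow_iff (norm_nonneg _) hδ.le (inv_pos.2 hs)).1 (by linarith)⟩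

/-- Super-exponential decay near a point does not depend on the window. -/
theorem SuperExpDecay.exists_change_window {t s : ℝ} {ht : 0 < t} {hs : 0 < s}
    {u : GSDual d t s} {ψ : GSSpace d t s} (hψ : ψ ≠ 0) (φ : GSSpace d t s) {z₀ : PhaseSpace d}
    {U : Set (PhaseSpace d)} (hU : IsOpen U) (hz₀ : z₀ ∈ U) (H : SuperExpDecay ht hs ψ u U) :
    ∃ V : Set (PhaseSpace d), IsOpen V ∧ V ⊆ U ∧ z₀ ∈ V ∧ SuperExpDecay ht hs φ u V := by
  obtain ⟨δ, hδ, hball⟩ := Metric.isOpen_iff.1 hU z₀ hz₀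
  have hδ2 : 0 < δ / 2 := by positivity
  refine ⟨Metric.ball z₀ (δ / 2), Metric.isOpen_ball,
    (Metric.ball_subset_ball (by linarith)).trans hball, Metric.mem_ball_self hδ2,
    fun ρ hρ => ?_⟩
  -- Weight at most ε forces norm less than δ / 2, so such a perturbation of a point of the half
  -- ball stays in U.
  obtain ⟨ε, hε0, hεm⟩ : ∃ ε : ℝ, 0 < ε ∧ ε < min ((δ / 2) ^ t⁻¹) ((δ / 2) ^ s⁻¹) :=
    exists_between (lt_min (by positivity) (by positivity))
  have hmem : ∀ z ∈ Metric.ball z₀ (δ / 2), ∀ w, phaseWeight t s w ≤ ε → z + w ∈ U := by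
    intro z hz w hw
    have h1 := norm_lt_of_phaseWeight_le ht hs hδ2 (hεm.trans_le (min_le_left _ _))
      (hεm.trans_le (min_le_right _ _)) hw
    refine hball ?_
    rw [Metric.mem_ball, dist_eq_norm] at hz ⊢
    calc ‖z + w - z₀‖ = ‖(z - z₀) + w‖ := by congr 1; abel
      _ ≤ ‖z - z₀‖ + ‖w‖ := norm_add_le _ _
      _ < δ := by linarith
  set R : ℝ := (‖z₀‖ + δ) ^ t⁻¹ + (‖z₀‖ + δ) ^ s⁻¹ with hR
  have hR0 : 0 < R := by positivity
  have hbdd : ∀ z ∈ Metric.ball z₀ (δ / 2), phaseWeight t s z ≤ R := by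
    intro z hz
    rw [Metric.mem_ball, dist_eq_norm] at hz
    have h1 : ‖z‖ ≤ ‖z₀‖ + δ := by
      have := norm_add_le z₀ (z - z₀)
      rw [add_sub_cancel] at this
      linarith
    exact add_le_add
      (Real.rpow_le_rpow (norm_nonneg _) ((norm_fst_le z).trans h1) (inv_pos.2 ht).le)
      (Real.rpow_le_rpow (norm_nonneg _) ((norm_snd_le z).trans h1) (inv_pos.2 hs).le)
  obtain ⟨c, hc0, hc, hle⟩ := exists_norm_stft_le_integral ht hs hψ φ
  obtain ⟨B, r, hB0, hr, hB⟩ := exists_norm_stft_le ht hs ψ u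
  obtain ⟨K, hK0, hK⟩ := exists_phaseWeight_add_le (d := d) ht hs
  obtain ⟨D, hD⟩ := H ρ hρ
  obtain ⟨C₁, hC₁0, hC₁⟩ := hc 1 one_pos
  -- Where N > ελ, the factor e^{-τN} is at most e^{-(rKR + ρ)λ}. This pays for the growth of V_ψ u
  -- at the dilated centre, whose weight is at most Rλ, and for the required e^{-ρλ}.
  set τ : ℝ := (r * K * R + ρ) / ε with hτ
  have hτ0 : 0 < τ := by positivity
  obtain ⟨C₂, hC₂0, hC₂⟩ := hc (r * K + 1 + τ) (by positivity)
  set M : ℝ := C₁ * max D 0 + C₂ * B with hM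
  have hM0 : 0 ≤ M := by positivity
  refine ⟨M * ∫ w : PhaseSpace d, Real.exp (-phaseWeight t s w), fun l hl z hz => ?_⟩
  have key : ∀ w, c w * ‖stft ht hs ψ u ((l ^ t • z.1, l ^ s • z.2) + freqScale w)‖ ≤
      M * Real.exp (-(ρ * l)) * Real.exp (-phaseWeight t s w) := by
    intro w
    set N := phaseWeight t s (freqScale w) with hN
    have hwN : phaseWeight t s w ≤ N := phaseWeight_le_freqScale hs w
    suffices hsuff : c w * ‖stft ht hs ψ u ((l ^ t • z.1, l ^ s • z.2) + freqScale w)‖ ≤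
        M * Real.exp (-(ρ * l)) * Real.exp (-N) by
      refine hsuff.trans ?_
      gcongr
    rcases le_or_gt N (ε * l) with hNl | hNl
    -- Near region: by homogeneity the undilated shift has weight at most ε, so the argument is the
    -- dilate of a point of U.
    · set w' : PhaseSpace d := (l⁻¹ ^ t • (freqScale w).1, l⁻¹ ^ s • (freqScale w).2) with hw'
      have h1 : phaseWeight t s w' ≤ ε := by
        rw [hw', phaseWeight_dilation ht hs (by positivity), inv_mul_le_iff₀ hl, mul_comm]
        exact hNl
      have hcancel : ∀ (q : ℝ) (x : RSpace d), l ^ q • (l⁻¹ ^ q • x) = x := by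
        intro q x
        rw [smul_smul, ← Real.mul_rpow hl.le (by positivity), mul_inv_cancel₀ hl.ne',
          Real.one_rpow, one_smul]
      have h2 : ((l ^ t • z.1, l ^ s • z.2) : PhaseSpace d) + freqScale w =
          (l ^ t • (z + w').1, l ^ s • (z + w').2) := by
        ext1
        · simp only [Prod.fst_add, smul_add, hw', hcancel]
        · simp only [Prod.snd_add, smul_add, hw', hcancel]
      have h3 := hD l hl (z + w') (hmem z hz w' h1)
      rw [← h2] at h3
      have h4 : ‖stft ht hs ψ u ((l ^ t • z.1, l ^ s • z.2) + freqScale w)‖ ≤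
          max D 0 * Real.exp (-(ρ * l)) := by
        rw [Real.exp_neg, ← div_eq_mul_inv, le_div_iff₀ (Real.exp_pos _), mul_comm]
        exact h3.trans (le_max_left _ _)
      have h5 := hC₁ w
      rw [one_mul] at h5
      calc c w * ‖stft ht hs ψ u ((l ^ t • z.1, l ^ s • z.2) + freqScale w)‖
          ≤ (C₁ * Real.exp (-N)) * (max D 0 * Real.exp (-(ρ * l))) :=
            mul_le_mul h5 h4 (norm_nonneg _) (by positivity)
        _ = C₁ * max D 0 * Real.exp (-(ρ * l)) * Real.exp (-N) := by ring
        _ ≤ _ := by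
            gcongr
            exact le_add_of_nonneg_right (by positivity)
    -- Far region: only the exponential growth of V_ψ u is available, and the kernel compensates for
    -- it.
    · have h1 := hB ((l ^ t • z.1, l ^ s • z.2) + freqScale w)
      have h2 := hK (l ^ t • z.1, l ^ s • z.2) (freqScale w)
      rw [phaseWeight_dilation ht hs hl.le] at h2
      have h3 : r * phaseWeight t s ((l ^ t • z.1, l ^ s • z.2) + freqScale w) ≤
          r * (K * (l * R + N)) := by
        refine mul_le_mul_of_nonneg_left (h2.trans ?_) hr.le
        have := hbdd z hz
        gcongr
      have h4 : (r * K * R + ρ) * l ≤ τ * N := by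
        have h5 : τ * (ε * l) = (r * K * R + ρ) * l := by
          rw [hτ]; field_simp
        rw [← h5]
        exact mul_le_mul_of_nonneg_left hNl.le hτ0.le
      calc c w * ‖stft ht hs ψ u ((l ^ t • z.1, l ^ s • z.2) + freqScale w)‖
          ≤ (C₂ * Real.exp (-((r * K + 1 + τ) * N))) * (B * Real.exp (r * (K * (l * R + N)))) :=
            mul_le_mul (hC₂ w) (h1.trans (mul_le_mul_of_nonneg_left
              (Real.exp_le_exp.2 h3) hB0)) (norm_nonneg _) (by positivity)
        _ = C₂ * B * Real.exp (-((r * K + 1 + τ) * N) + r * (K * (l * R + N))) := by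
            rw [Real.exp_add]; ring
        _ ≤ C₂ * B * Real.exp (-(ρ * l) + -N) :=
            mul_le_mul_of_nonneg_left (Real.exp_le_exp.2 (by linarith)) (by positivity)
        _ = C₂ * B * Real.exp (-(ρ * l)) * Real.exp (-N) := by rw [Real.exp_add, ← mul_assoc]
        _ ≤ _ := by
            gcongr
            exact le_add_of_nonneg_left (by positivity)
  have h1 : ‖stft ht hs φ u (l ^ t • z.1, l ^ s • z.2)‖ ≤
      M * Real.exp (-(ρ * l)) * ∫ w : PhaseSpace d, Real.exp (-phaseWeight t s w) := by
    refine (hle u _).trans ?_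
    rw [← integral_const_mul]
    exact integral_mono_of_nonneg
      (Filter.Eventually.of_forall fun w => mul_nonneg (hc0 w) (norm_nonneg _))
      ((integrable_exp_neg_phaseWeight ht hs).const_mul _) (Filter.Eventually.of_forall key)
  refine (mul_le_mul_of_nonneg_left h1 (Real.exp_pos _).le).trans_eq ?_
  rw [Real.exp_neg]
  field_simp

/-- By contraposition: decay measured with φ passes to ψ. Only the window from which one starts has
to be nonzero, because the reproducing formula divides by its norm. -/
lemma waveFrontSet_subset {t s : ℝ} (ht : 0 < t) (hs : 0 < s) (u : GSDual d t s)
    (ψ : GSSpace d t s) {φ : GSSpace d t s} (hφ : φ ≠ 0) :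
    waveFrontSet ht hs ψ u ⊆ waveFrontSet ht hs φ u := by
  rintro z ⟨hz, hn⟩
  refine ⟨hz, ?_⟩
  rintro ⟨U, hU, hU0, hzU, H⟩
  obtain ⟨V, hV, hVU, hzV, HV⟩ := H.exists_change_window hφ ψ hU hzU
  exact hn ⟨V, hV, hVU.trans hU0, hzV, HV⟩

end ChangeOfWindow

end GelfandShilov

end

open GelfandShilov in
theorem proposition3p5 {d : ℕ} {t s : ℝ} (ht : 0 < t) (hs : 0 < s) (hts : 1 < s + t)
    (u : GSDual d t s) (ψ φ : GSSpace d t s) (hψ : ψ ≠ 0) (hφ : φ ≠ 0) :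
    (∀ z₀ : PhaseSpace d, z₀ ≠ 0 → ∀ U : Set (PhaseSpace d), IsOpen U → U ⊆ {0}ᶜ → z₀ ∈ U →
      SuperExpDecay ht hs ψ u U →
      ∃ V : Set (PhaseSpace d), IsOpen V ∧ V ⊆ U ∧ z₀ ∈ V ∧ SuperExpDecay ht hs φ u V) ∧
    waveFrontSet ht hs ψ u = waveFrontSet ht hs φ u :=
  ⟨fun _ _ _ hU _ hz₀ H => H.exists_change_window hψ φ hU hz₀,
    (waveFrontSet_subset ht hs u ψ hφ).antisymm (waveFrontSet_subset ht hs u φ hψ)⟩
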